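/- Let $(a,b)\subseteq\mathbb{R}$ be a nonempty open interval, $-\infty\le a<b\le\infty$, and let $p,q,r,s$ be Lebesgue measurable real-valued functions on $(a,b)$ with $p^{-1},q,r,s\in L^1_{\mathrm{loc}}((a,b);dx)$, $r>0$ a.e. and $p\neq 0$ a.e. on $(a,b)$. Let $\mathfrak{D}_\tau$ be the set of all $f\in AC_{\mathrm{loc}}((a,b))$ such that $f^{[1]}:=p\,[f'+sf]$ belongs to $AC_{\mathrm{loc}}((a,b))$ (that is, agrees a.e. with such a function), and for $f\in\mathfrak{D}_\tau$ put $$\tau f=\frac1r\Big(-\big(f^{[1]}\big)'+s f^{[1]}+qf\Big).$$ In the complex Hilbert space $L^2((a,b);r(x)\,dx)$ with inner product $\langle\cdot,\cdot\rangle_r$, let $T_{\max}f=\tau f$ on $\operatorname{dom}(T_{\max})=\{g\in L^2((a,b);r\,dx): g\in\mathfrak{D}_\tau,\ \tau g\in L^2((a,b);r\,dx)\}$, let $T_0$ be the restriction of $T_{\max}$ to the functions in $\operatorname{dom}(T_{\max})$ with compact support in $(a,b)$, and let $T_{\min}=\overline{T_0}$ be the closure of $T_0$. For $\lambda\in\mathbb{R}$,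 the expression $\tau-\lambda$ is called oscillatory at $a$ (resp. $b$) if some nontrivial real-valued solution $u\in\mathfrak{D}_\tau$ of $-(u^{[1]})'+su^{[1]}+qu=\lambda ur$ has infinitely many zeros accumulating at $a$ (resp. $b$), and non-oscillatory at $a$ (resp. $b$) otherwise. Suppose that $p>0$ a.e. on $(a,b)$ and that there exist $\lambda_a,\lambda_b\in\mathbb{R}$ such that $\tau-\lambda_a$ is non-oscillatory at $a$ and $\tau-\lambda_b$ is non-oscillatory at $b$. Then $T_0$ is bounded from below, and so is every self-adjoint extension $S$ of $T_{\min}$. That is, there exists $\gamma_0\in\mathbb{R}$ with $\langle u,T_0u\rangle_r\ge\gamma_0\langle u,u\rangle_r$ for all $u\in\operatorname{dom}(T_0)$, and for every self-adjoint extension $S$ of $T_{\min}$ there exists $\gamma_S\in\mathbb{R}$ such that $$\langle u,Su\rangle_r\ge\gamma_S\langle u,u\rangle_r,\qquad u\in\operatorname{dom}(S).$$ -/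

import Mathlib

open MeasureTheory Set

noncomputable section

/-- The data of a Sturm--Liouville differential expression with four coefficients
`τ f = r⁻¹ (-(f^[1])' + s f^[1] + q f)`, `f^[1] = p (f' + s f)`, on an open interval `(a, b)` whose
endpoints may be infinite. The coefficients only matter on `(a, b)`. -/
structure SLExpr where
  a : EReal
  b : EReal
  p : ℝ → ℝ
  q : ℝ → ℝ
  r : ℝ → ℝ
  s : ℝ → ℝ

namespace SLExpr

/-- The interval `(a, b)`, as a set of real numbers. -/
def I (τ : SLExpr) : Set ℝ := {x : ℝ | τ.a < (x : EReal) ∧ (x : EReal) < τ.b}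

/-- The standing assumptions: `(a, b)` is a nonempty open interval, the (real-valued) coefficients
are Lebesgue measurable on it, `p⁻¹, q, r, s ∈ L¹_loc((a, b); dx)`, and `r > 0`, `p ≠ 0` a.e. -/
structure Hypothesis (τ : SLExpr) : Prop where
  a_lt_b : τ.a < τ.b
  p_meas : AEMeasurable τ.p (volume.restrict τ.I)
  q_meas : AEMeasurable τ.q (volume.restrict τ.I)
  r_meas : AEMeasurable τ.r (volume.restrict τ.I)
  s_meas : AEMeasurable τ.s (volume.restrict τ.I)
  p_inv_loc : LocallyIntegrableOn (fun x => (τ.p x)⁻¹) τ.I volume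
  q_loc : LocallyIntegrableOn τ.q τ.I volume
  r_loc : LocallyIntegrableOn τ.r τ.I volume
  s_loc : LocallyIntegrableOn τ.s τ.I volume
  r_pos : ∀ᵐ x ∂(volume.restrict τ.I), 0 < τ.r x
  p_ne : ∀ᵐ x ∂(volume.restrict τ.I), τ.p x ≠ 0

section Functions

variable {E : Type*} [NormedAddCommGroup E] [NormedSpace ℝ E]

/-- `f ∈ AC_loc((a, b))`: absolutely continuous on every compact subinterval of `(a, b)`. -/
def ACLoc (τ : SLExpr) (f : ℝ → E) : Prop :=
  ∀ x ∈ τ.I, ∀ y ∈ τ.I, AbsolutelyContinuousOnInterval f x y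

/-- `f` belongs to `𝔇_τ` and `f₁` is its first quasi-derivative: `f ∈ AC_loc((a, b))`, and
`f₁ ∈ AC_loc((a, b))` is the (unique) continuous representative of `p (f' + s f)`. -/
structure HasQuasiDeriv (τ : SLExpr) (f f₁ : ℝ → E) : Prop where
  acLoc : τ.ACLoc f
  acLoc_quasi : τ.ACLoc f₁
  eq_ae : ∀ᵐ x ∂(volume.restrict τ.I), f₁ x = τ.p x • (deriv f x + τ.s x • f x)

/-- The function `τ f = r⁻¹ (-(f^[1])' + s f^[1] + q f)`, where `f₁ = f^[1]`. -/
def apply (τ : SLExpr) (f f₁ : ℝ → E) (x : ℝ) : E :=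
  (τ.r x)⁻¹ • (-deriv f₁ x + τ.s x • f₁ x + τ.q x • f x)

end Functions

/-- `u` is a real-valued solution in `𝔇_τ` of `-(u^[1])' + s u^[1] + q u = lam u r`
a.e. on `(a, b)`. -/
def IsRealSolution (τ : SLExpr) (lam : ℝ) (u : ℝ → ℝ) : Prop :=
  ∃ u₁ : ℝ → ℝ, τ.HasQuasiDeriv u u₁ ∧
    ∀ᵐ x ∂(volume.restrict τ.I),
      -deriv u₁ x + τ.s x * u₁ x + τ.q x * u x = lam * u x * τ.r x

/-- `τ - lam` is oscillatory at `a`: some nontrivial real-valued solution has zeros in `(a, b)`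
arbitrarily close to `a` (hence infinitely many zeros accumulating at `a ∉ (a, b)`). -/
def OscillatoryAtLeft (τ : SLExpr) (lam : ℝ) : Prop :=
  ∃ u : ℝ → ℝ, τ.IsRealSolution lam u ∧ (∃ x ∈ τ.I, u x ≠ 0) ∧
    ∀ c ∈ τ.I, ∃ x ∈ τ.I, x < c ∧ u x = 0

/-- `τ - lam` is oscillatory at `b`. -/
def OscillatoryAtRight (τ : SLExpr) (lam : ℝ) : Prop :=
  ∃ u : ℝ → ℝ, τ.IsRealSolution lam u ∧ (∃ x ∈ τ.I, u x ≠ 0) ∧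
    ∀ c ∈ τ.I, ∃ x ∈ τ.I, c < x ∧ u x = 0

/-- `τ - lam` is non-oscillatory at `a`. -/
def NonOscillatoryAtLeft (τ : SLExpr) (lam : ℝ) : Prop := ¬ τ.OscillatoryAtLeft lam

/-- `τ - lam` is non-oscillatory at `b`. -/
def NonOscillatoryAtRight (τ : SLExpr) (lam : ℝ) : Prop := ¬ τ.OscillatoryAtRight lam

/-- The measure `r(x) dx` on `(a, b)`. -/
def weight (τ : SLExpr) : Measure ℝ :=
  (volume.restrict τ.I).withDensity (fun x => ENNReal.ofReal (τ.r x))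

/-- The complex Hilbert space `L²((a, b); r(x) dx)`. -/
abbrev L2 (τ : SLExpr) : Type := Lp ℂ 2 τ.weight

theorem isOpen_I (τ : SLExpr) : IsOpen τ.I :=
  (isOpen_Ioo (a := τ.a) (b := τ.b)).preimage continuous_coe_real_ereal

theorem uIcc_subset_I (τ : SLExpr) {x y : ℝ} (hx : x ∈ τ.I) (hy : y ∈ τ.I) : uIcc x y ⊆ τ.I := by
  have h : OrdConnected τ.I :=
    ⟨fun u hu v hv z hz => ⟨hu.1.trans_le (EReal.coe_le_coe_iff.2 hz.1),
      (EReal.coe_le_coe_iff.2 hz.2).trans_lt hv.2⟩⟩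
  exact h.uIcc_subset hx hy

theorem ae_weight {τ : SLExpr} {P : ℝ → Prop} (h : ∀ᵐ x ∂(volume.restrict τ.I), P x) :
    ∀ᵐ x ∂τ.weight, P x :=
  (withDensity_absolutelyContinuous _ _).ae_le h

theorem ACLoc.ae_differentiableAt {τ : SLExpr} {f : ℝ → ℂ} (hf : τ.ACLoc f) :
    ∀ᵐ x ∂(volume.restrict τ.I), DifferentiableAt ℝ f x := by
  refine ae_restrict_of_ae_restrict_inter_Ioo fun x y hx hy hxy => ?_
  rw [ae_restrict_iff' (τ.isOpen_I.measurableSet.inter measurableSet_Ioo)]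
  filter_upwards [(hf x hx y hy).boundedVariationOn.ae_differentiableAt_of_mem_uIcc] with z hz h
  exact hz (Icc_subset_uIcc (Ioo_subset_Icc_self h.2))

theorem ACLoc.continuousOn {τ : SLExpr} {f : ℝ → ℂ} (hf : τ.ACLoc f) : ContinuousOn f τ.I := by
  intro x hx
  obtain ⟨ε, hε, hball⟩ := Metric.isOpen_iff.1 τ.isOpen_I x hx
  have h1 : x - ε / 2 ∈ τ.I :=
    hball (by rw [Metric.mem_ball, Real.dist_eq, abs_lt]; constructor <;> linarith)
  have h2 : x + ε / 2 ∈ τ.I :=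
    hball (by rw [Metric.mem_ball, Real.dist_eq, abs_lt]; constructor <;> linarith)
  refine ((hf _ h1 _ h2).continuousOn.continuousAt ?_).continuousWithinAt
  rw [uIcc_of_le (by linarith)]
  exact Icc_mem_nhds (by linarith) (by linarith)

theorem HasQuasiDeriv.zero (τ : SLExpr) : τ.HasQuasiDeriv (0 : ℝ → ℂ) 0 := by
  have h : τ.ACLoc (0 : ℝ → ℂ) := fun x _ y _ =>
    (LipschitzWith.const (0 : ℂ)).lipschitzOnWith.absolutelyContinuousOnInterval
  exact ⟨h, h, by simp⟩

theorem HasQuasiDeriv.add {τ : SLExpr} {f f₁ g g₁ : ℝ → ℂ} (hf : τ.HasQuasiDeriv f f₁)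
    (hg : τ.HasQuasiDeriv g g₁) : τ.HasQuasiDeriv (f + g) (f₁ + g₁) := by
  refine ⟨fun x hx y hy => (hf.acLoc x hx y hy).add (hg.acLoc x hx y hy),
    fun x hx y hy => (hf.acLoc_quasi x hx y hy).add (hg.acLoc_quasi x hx y hy), ?_⟩
  filter_upwards [hf.eq_ae, hg.eq_ae, hf.acLoc.ae_differentiableAt, hg.acLoc.ae_differentiableAt]
    with x h1 h2 h3 h4
  rw [deriv_add h3 h4, Pi.add_apply, Pi.add_apply, h1, h2]
  module

theorem HasQuasiDeriv.smul {τ : SLExpr} {f f₁ : ℝ → ℂ} (c : ℂ) (hf : τ.HasQuasiDeriv f f₁) :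
    τ.HasQuasiDeriv (c • f) (c • f₁) := by
  refine ⟨fun x hx y hy => (hf.acLoc x hx y hy).const_smul c,
    fun x hx y hy => (hf.acLoc_quasi x hx y hy).const_smul c, ?_⟩
  filter_upwards [hf.eq_ae] with x h1
  rw [deriv_const_smul_field, Pi.smul_apply, Pi.smul_apply, h1]
  simp only [Complex.real_smul, smul_eq_mul]
  ring

theorem apply_add_ae {τ : SLExpr} {f f₁ g g₁ : ℝ → ℂ} (hf : τ.HasQuasiDeriv f f₁)
    (hg : τ.HasQuasiDeriv g g₁) :
    ∀ᵐ x ∂τ.weight, τ.apply (f + g) (f₁ + g₁) x = τ.apply f f₁ x + τ.apply g g₁ x := by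
  apply ae_weight
  filter_upwards [hf.acLoc_quasi.ae_differentiableAt, hg.acLoc_quasi.ae_differentiableAt]
    with x h3 h4
  simp only [apply]
  rw [deriv_add h3 h4, Pi.add_apply, Pi.add_apply]
  module

theorem apply_smul (τ : SLExpr) (c : ℂ) (f f₁ : ℝ → ℂ) (x : ℝ) :
    τ.apply (c • f) (c • f₁) x = c • τ.apply f f₁ x := by
  simp only [apply]
  rw [deriv_const_smul_field, Pi.smul_apply, Pi.smul_apply]
  simp only [Complex.real_smul, smul_eq_mul]
  ring

/-- The graph of the maximal operator: the pairs `(F, G)` in `L² × L²` such that `F` has a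
representative `f ∈ 𝔇_τ` with `G = τ f`. -/
def maxGraph (τ : SLExpr) : Submodule ℂ (τ.L2 × τ.L2) where
  carrier := {P | ∃ f f₁ : ℝ → ℂ, τ.HasQuasiDeriv f f₁ ∧
    (∀ᵐ x ∂τ.weight, P.1 x = f x) ∧ (∀ᵐ x ∂τ.weight, P.2 x = τ.apply f f₁ x)}
  zero_mem' := by
    refine ⟨0, 0, HasQuasiDeriv.zero τ, Lp.coeFn_zero _ _ _, ?_⟩
    filter_upwards [Lp.coeFn_zero ℂ 2 τ.weight] with x hx
    refine hx.trans ?_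
    simp [apply]
  add_mem' := by
    rintro P Q ⟨f, f₁, hf, hP1, hP2⟩ ⟨g, g₁, hg, hQ1, hQ2⟩
    refine ⟨f + g, f₁ + g₁, hf.add hg, ?_, ?_⟩
    · filter_upwards [Lp.coeFn_add P.1 Q.1, hP1, hQ1] with x h h1 h2
      rw [Prod.fst_add, h, Pi.add_apply, Pi.add_apply, h1, h2]
    · filter_upwards [Lp.coeFn_add P.2 Q.2, hP2, hQ2, apply_add_ae hf hg] with x h h1 h2 h3
      rw [Prod.snd_add, h, Pi.add_apply, h1, h2, h3]
  smul_mem' := by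
    rintro c P ⟨f, f₁, hf, hP1, hP2⟩
    refine ⟨c • f, c • f₁, hf.smul c, ?_, ?_⟩
    · filter_upwards [Lp.coeFn_smul c P.1, hP1] with x h h1
      rw [Prod.smul_fst, h, Pi.smul_apply, Pi.smul_apply, h1]
    · filter_upwards [Lp.coeFn_smul c P.2, hP2] with x h h1
      rw [Prod.smul_snd, h, Pi.smul_apply, h1, apply_smul]

/-- The maximal operator `T_max` in `L²((a, b); r(x) dx)`; see `graph_Tmax`. -/
def Tmax (τ : SLExpr) : τ.L2 →ₗ.[ℂ] τ.L2 := τ.maxGraph.toLinearPMap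

/-- The elements of `L²((a, b); r(x) dx)` with compact support in `(a, b)`. -/
def compactSupp (τ : SLExpr) : Submodule ℂ τ.L2 where
  carrier := {F | ∃ K : Set ℝ, IsCompact K ∧ K ⊆ τ.I ∧ ∀ᵐ x ∂τ.weight, x ∉ K → F x = 0}
  zero_mem' := by
    refine ⟨∅, isCompact_empty, empty_subset _, ?_⟩
    filter_upwards [Lp.coeFn_zero ℂ 2 τ.weight] with x hx _
    exact hx
  add_mem' := by
    rintro F G ⟨K, hK, hKI, hF⟩ ⟨L, hL, hLI, hG⟩
    refine ⟨K ∪ L, hK.union hL, union_subset hKI hLI, ?_⟩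
    filter_upwards [Lp.coeFn_add F G, hF, hG] with x h h1 h2 hx
    rw [h, Pi.add_apply, h1 (fun hk => hx (Or.inl hk)), h2 (fun hk => hx (Or.inr hk)), add_zero]
  smul_mem' := by
    rintro c F ⟨K, hK, hKI, hF⟩
    refine ⟨K, hK, hKI, ?_⟩
    filter_upwards [Lp.coeFn_smul c F, hF] with x h h1 hx
    rw [h, Pi.smul_apply, h1 hx, smul_zero]

/-- `T_0`: the restriction of `T_max` to the functions with compact support in `(a, b)`. -/
def T0 (τ : SLExpr) : τ.L2 →ₗ.[ℂ] τ.L2 := τ.Tmax.domRestrict τ.compactSupp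

/-- The minimal operator `T_min`, the closure of `T_0`. -/
def Tmin (τ : SLExpr) : τ.L2 →ₗ.[ℂ] τ.L2 := τ.T0.closure

theorem Hypothesis.ae_of_ae_weight {τ : SLExpr} (h : τ.Hypothesis) {P : ℝ → Prop}
    (hP : ∀ᵐ x ∂τ.weight, P x) : ∀ᵐ x ∂(volume.restrict τ.I), P x := by
  have h1 := (ae_withDensity_iff' h.r_meas.ennreal_ofReal).1 hP
  filter_upwards [h1, h.r_pos] with x hx hr
  exact hx (by simpa using hr)

/-- The maximal operator is well defined: `τ f` depends only on the class of `f`. -/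
theorem graph_Tmax {τ : SLExpr} (h : τ.Hypothesis) : τ.Tmax.graph = τ.maxGraph := by
  refine Submodule.toLinearPMap_graph_eq _ ?_
  rintro ⟨F, G⟩ ⟨f, f₁, hf, hF, hG⟩ hF0
  obtain rfl : F = 0 := hF0
  have hd : ∀ g : ℝ → ℂ, EqOn g 0 τ.I → EqOn (deriv g) 0 τ.I := fun g hg x hx => by
    have : g =ᶠ[nhds x] fun _ => (0 : ℂ) := Filter.eventuallyEq_of_mem (τ.isOpen_I.mem_nhds hx) hg
    rw [this.deriv_eq]; simp
  have hf0 : EqOn f 0 τ.I := by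
    refine Measure.eqOn_open_of_ae_eq (μ := volume) ?_ τ.isOpen_I hf.acLoc.continuousOn
      continuousOn_const
    refine h.ae_of_ae_weight ?_
    filter_upwards [hF, Lp.coeFn_zero ℂ 2 τ.weight] with x h1 h2
    rw [← h1]; exact h2
  have hmem : ∀ᵐ x ∂(volume.restrict τ.I), x ∈ τ.I := ae_restrict_mem τ.isOpen_I.measurableSet
  have hf1 : EqOn f₁ 0 τ.I := by
    refine Measure.eqOn_open_of_ae_eq (μ := volume) ?_ τ.isOpen_I hf.acLoc_quasi.continuousOn
      continuousOn_const
    filter_upwards [hf.eq_ae, hmem] with x h1 hx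
    rw [h1, hd f hf0 hx, hf0 hx]; simp
  refine Lp.ext ?_
  filter_upwards [hG, Lp.coeFn_zero ℂ 2 τ.weight, ae_weight hmem] with x h1 h2 hx
  rw [h2]
  refine h1.trans ?_
  simp [apply, hd f₁ hf1 hx, hf1 hx, hf0 hx]

end SLExpr

open scoped ComplexOrder in
/-- A linear operator `T` in a complex Hilbert space is bounded from below if there is a real `γ`
with `⟨u, T u⟩ ≥ γ ⟨u, u⟩` for all `u ∈ dom T`. The order on `ℂ` is the one in which `z ≤ w` means
that `w - z` is a nonnegative real number, so the inequality includes that `⟨u, T u⟩` is real. -/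
def LinearPMap.IsBoundedFromBelow {H : Type*} [NormedAddCommGroup H] [InnerProductSpace ℂ H]
    (T : H →ₗ.[ℂ] H) : Prop :=
  ∃ γ : ℝ, ∀ u : T.domain, (γ : ℂ) * inner ℂ (u : H) (u : H) ≤ inner ℂ (u : H) (T u)

end

/-! ### Symmetric operators bounded below on a subspace of finite codimension. -/

section Abstract

variable {H : Type*} [NormedAddCommGroup H] [InnerProductSpace ℂ H]

/-! The lower bound for `T_0` is a Riccati (Picone) argument. Integration by parts turns the form of
`τ - γ` on real compactly supported `g` into the integral of `g₁² / p + q g² - γ r g²`, which is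
`formDensity`. If `φ' ≤ 2 s φ + q - φ² / p - γ r`, then `(φ g²)'` is at most this density minus `(g₁
- φ g)² / p`, so for `p > 0` the form over `[x, y]` is at least `φ(y) g(y)² - φ(x) g(x)²`
(`RiccatiLE.sub_le_integral`).

Near each endpoint non-oscillation gives a solution `u` without zeros, and `φ = u₁ / u` solves the
Riccati equation. On the compact interval `[c, d]` left in between, a sufficiently negative `γ`
leaves enough room to choose `φ` with any prescribed values at `c` and `d`
(`SLExpr.exists_riccatiLE`). With matching values the three boundary contributions telescope, and
they vanish at the ends of the support. Hence the form of `τ - γ` is nonnegative; complex functions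
reduce to their real and imaginary parts.

A self-adjoint extension `S` inherits the bound because the deficiency of `T_0 - lam` is finite for
real `lam`: a compactly supported `F` orthogonal to a fundamental system of `τ - lam` lies in the
range of `T_0 - lam`, by variation of constants (`finiteDimensional_orthogonal_range_T0`). For `lam
< γ` this forces the domain of the closure of `T_0` to have finite codimension in `dom S`. Finally,
a symmetric operator bounded below on a subspace of finite codimension is bounded below: otherwise
its shifted form would be negative definite on spaces of dimension larger than the codimension, and
such a space meets the subspace nontrivially. -/

theorem two_mul_mul_le_of_pos {δ : ℝ} (hδ : 0 < δ) (C x y : ℝ) :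
    2 * C * x * y ≤ δ / 2 * x ^ 2 + 2 * C ^ 2 / δ * y ^ 2 := by
  have h : 0 ≤ (δ * x - 2 * C * y) ^ 2 / (2 * δ) := by positivity
  have e : (δ * x - 2 * C * y) ^ 2 / (2 * δ) =
      δ / 2 * x ^ 2 + 2 * C ^ 2 / δ * y ^ 2 - 2 * C * x * y := by
    field_simp
    ring
  linarith

/-- If a symmetric operator is not bounded from below, then its quadratic form is negative
definite, uniformly, on subspaces of arbitrarily large finite dimension. -/
theorem LinearPMap.exists_finrank_le_neg_of_unbounded {S : H →ₗ.[ℂ] H} (hS : S.IsFormalAdjoint S)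
    (hub : ∀ M : ℝ, ∃ u : S.domain, (inner ℂ (u : H) (S u)).re < -M * ‖u‖ ^ 2) (n : ℕ) :
    ∃ W : Submodule ℂ S.domain, FiniteDimensional ℂ W ∧ n ≤ Module.finrank ℂ W ∧
      ∃ δ : ℝ, 0 < δ ∧ ∀ w ∈ W, (inner ℂ (w : H) (S w)).re ≤ -δ * ‖w‖ ^ 2 := by
  induction n with
  | zero =>
    refine ⟨⊥, inferInstance, Nat.zero_le _, 1, one_pos, fun w hw => ?_⟩
    rw [(Submodule.mem_bot ℂ).1 hw]
    simp
  | succ n ih =>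
    obtain ⟨W, hW, hn, δ, hδ, hneg⟩ := ih
    obtain ⟨C, hC0, hC⟩ : ∃ C : ℝ, 0 ≤ C ∧ ∀ w ∈ W, ‖S w‖ ≤ C * ‖w‖ := by
      let L : W →L[ℂ] H := LinearMap.toContinuousLinearMap (S.toFun ∘ₗ W.subtype)
      exact ⟨‖L‖, L.opNorm_nonneg, fun w hw => L.le_opNorm ⟨w, hw⟩⟩
    -- The summand `C` forces `v ∉ W`, since the form is at least `-C ‖·‖²` on `W`. The term `2 C² /
    -- δ` absorbs the cross terms between `W` and `v`, and `δ / 2` is the negativity that remains.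
    obtain ⟨v, hv⟩ := hub (δ / 2 + 2 * C ^ 2 / δ + C)
    have hK : 0 ≤ 2 * C ^ 2 / δ := by positivity
    have hvW : v ∉ W := fun hvW => by
      have h1 : -(‖(v : H)‖ * ‖S v‖) ≤ (inner ℂ (v : H) (S v)).re :=
        (abs_le.1 ((Complex.abs_re_le_norm _).trans (norm_inner_le_norm _ _))).1
      have h2 : ‖(v : H)‖ * ‖S v‖ ≤ ‖(v : H)‖ * (C * ‖v‖) :=
        mul_le_mul_of_nonneg_left (hC v hvW) (norm_nonneg _)
      have h3 : ‖(v : H)‖ = ‖v‖ := rfl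
      rw [h3] at h1 h2
      nlinarith [sq_nonneg ‖v‖, mul_nonneg hK (sq_nonneg ‖v‖), mul_nonneg hδ.le (sq_nonneg ‖v‖)]
    -- After Young's inequality the form at `w + z` is at most `-(δ / 2)(‖w‖² + ‖z‖²)`; passing to
    -- `‖w + z‖²` costs another factor 2.
    refine ⟨W ⊔ Submodule.span ℂ {v}, inferInstance, ?_, δ / 4, by positivity, ?_⟩
    · refine hn.trans_lt (Submodule.finrank_lt_finrank_of_lt ?_)
      exact SetLike.lt_iff_le_and_exists.2 ⟨le_sup_left, v,
        Submodule.mem_sup_right (Submodule.mem_span_singleton_self v), hvW⟩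
    · intro x hx
      obtain ⟨w, hw, y, hy, rfl⟩ := Submodule.mem_sup.1 hx
      obtain ⟨c, rfl⟩ := Submodule.mem_span_singleton.1 hy
      have hq : (inner ℂ ((c • v : S.domain) : H) (S (c • v))).re ≤
          -(δ / 2 + 2 * C ^ 2 / δ) * ‖c • v‖ ^ 2 := by
        have e : inner ℂ ((c • v : S.domain) : H) (S (c • v)) =
            ((‖c‖ ^ 2 : ℝ) : ℂ) * inner ℂ (v : H) (S v) := by
          rw [LinearPMap.map_smul, Submodule.coe_smul, inner_smul_left, inner_smul_right,
            ← mul_assoc, Complex.conj_mul']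
          push_cast
          rfl
        rw [e, Complex.re_ofReal_mul, norm_smul, mul_pow]
        nlinarith [sq_nonneg ‖c‖, mul_nonneg (sq_nonneg ‖c‖) (mul_nonneg hC0 (sq_nonneg ‖v‖)),
          mul_le_mul_of_nonneg_left hv.le (sq_nonneg ‖c‖)]
      generalize c • v = z at hq
      have hcross : (inner ℂ (w : H) (S z)).re ≤ C * ‖w‖ * ‖z‖ := by
        rw [← hS w z]
        refine (Complex.re_le_norm _).trans ((norm_inner_le_norm _ _).trans ?_)
        exact mul_le_mul_of_nonneg_right (hC w hw) (norm_nonneg _)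
      have hcross' : (inner ℂ (z : H) (S w)).re ≤ C * ‖w‖ * ‖z‖ := by
        refine (Complex.re_le_norm _).trans ((norm_inner_le_norm _ _).trans ?_)
        rw [mul_comm]
        exact mul_le_mul_of_nonneg_right (hC w hw) (norm_nonneg _)
      have hsum : inner ℂ ((w + z : S.domain) : H) (S (w + z)) =
          inner ℂ (w : H) (S w) + inner ℂ (w : H) (S z) + inner ℂ (z : H) (S w)
            + inner ℂ (z : H) (S z) := by
        rw [LinearPMap.map_add, Submodule.coe_add, inner_add_left, inner_add_right,
          inner_add_right]
        ring
      have hnorm : ‖w + z‖ ^ 2 ≤ 2 * ‖w‖ ^ 2 + 2 * ‖z‖ ^ 2 := by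
        have := pow_le_pow_left₀ (norm_nonneg _) (norm_add_le w z) 2
        nlinarith [sq_nonneg (‖w‖ - ‖z‖)]
      rw [hsum]
      simp only [Complex.add_re]
      nlinarith [hneg w hw, two_mul_mul_le_of_pos hδ C ‖w‖ ‖z‖]

/-- A symmetric operator that is bounded from below on a subspace of finite codimension of its
domain is bounded from below. -/
theorem LinearPMap.bounded_below_of_coFG {S : H →ₗ.[ℂ] H} (hS : S.IsFormalAdjoint S)
    {D : Submodule ℂ S.domain} (hD : D.CoFG) {γ : ℝ}
    (hγ : ∀ u ∈ D, γ * ‖u‖ ^ 2 ≤ (inner ℂ (u : H) (S u)).re) :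
    ∃ γ' : ℝ, ∀ u : S.domain, γ' * ‖u‖ ^ 2 ≤ (inner ℂ (u : H) (S u)).re := by
  by_contra! hub
  -- The shift makes the form nonnegative on `D`, so that a space on which it is negative definite
  -- injects into `S.domain ⧸ D`.
  let Sγ : H →ₗ.[ℂ] H := ⟨S.domain, S.toFun - (γ : ℂ) • S.domain.subtype⟩
  have happ : ∀ u : S.domain, Sγ u = S u - (γ : ℂ) • (u : H) := fun u => rfl
  have hform : ∀ u : S.domain,
      (inner ℂ (u : H) (Sγ u)).re = (inner ℂ (u : H) (S u)).re - γ * ‖u‖ ^ 2 := fun u => by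
    rw [happ, inner_sub_right, inner_smul_right, inner_self_eq_norm_sq_to_K]
    norm_num [← Complex.ofReal_pow]
  have hsymm : Sγ.IsFormalAdjoint Sγ := fun u v => by
    rw [happ, happ, inner_sub_left, inner_sub_right, inner_smul_left, inner_smul_right, hS u v]
    simp
  obtain ⟨W, hW, hn, δ, hδ, hneg⟩ := LinearPMap.exists_finrank_le_neg_of_unbounded hsymm
    (fun M => by
      obtain ⟨u, hu⟩ := hub (γ - M)
      exact ⟨u, by rw [hform]; linarith⟩) (Module.finrank ℂ (S.domain ⧸ D) + 1)
  have hinj : Function.Injective (D.mkQ ∘ₗ W.subtype) := by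
    rw [← LinearMap.ker_eq_bot, Submodule.eq_bot_iff]
    intro w hw
    have hwD : (w : S.domain) ∈ D := by simpa using hw
    have h1 := hneg w w.2
    rw [hform] at h1
    have h2 := hγ w hwD
    have h3 : ‖(w : S.domain)‖ ^ 2 ≤ 0 := by nlinarith
    have h4 : ‖(w : S.domain)‖ = 0 := by nlinarith [norm_nonneg (w : S.domain)]
    exact Subtype.ext (norm_eq_zero.1 h4)
  have := LinearMap.finrank_le_finrank_of_injective hinj
  omega

variable [CompleteSpace H]

/-- A closed symmetric extension `S` of an operator `T` which is bounded from below by `γ` is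
bounded from below if `T - lam` has finite deficiency for some `lam < γ`. -/
theorem LinearPMap.bounded_below_of_finite_deficiency {S T : H →ₗ.[ℂ] H}
    (hS : S.IsFormalAdjoint S) (hcl : S.IsClosed) (hTS : T ≤ S) {γ lam : ℝ} (hlam : lam < γ)
    (hγ : ∀ u : T.domain, γ * ‖u‖ ^ 2 ≤ (inner ℂ (u : H) (T u)).re)
    (hfin : FiniteDimensional ℂ
      (T.graph.map (LinearMap.snd ℂ H H - (lam : ℂ) • LinearMap.fst ℂ H H))ᗮ) :
    ∃ γ' : ℝ, ∀ u : S.domain, γ' * ‖u‖ ^ 2 ≤ (inner ℂ (u : H) (S u)).re := by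
  set L : H × H →L[ℂ] H := ContinuousLinearMap.snd ℂ H H - (lam : ℂ) • ContinuousLinearMap.fst ℂ H H
    with hL
  have hLL : LinearMap.snd ℂ H H - (lam : ℂ) • LinearMap.fst ℂ H H = L.toLinearMap := rfl
  have hLapp : ∀ z, L z = z.2 - (lam : ℂ) • z.1 := fun z => rfl
  rw [hLL] at hfin
  set G := T.graph.topologicalClosure with hG
  set R := T.graph.map L.toLinearMap with hR
  have hform : ∀ z ∈ G, γ * ‖z.1‖ ^ 2 ≤ (inner ℂ z.1 z.2).re := by
    have hc : _root_.IsClosed {z : H × H | γ * ‖z.1‖ ^ 2 ≤ (inner ℂ z.1 z.2).re} :=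
      isClosed_le (by fun_prop)
        (Complex.continuous_re.comp (continuous_fst.inner continuous_snd))
    refine fun z hz => closure_minimal ?_ hc hz
    rintro z hz
    obtain ⟨y, hy1, hy2⟩ := LinearPMap.mem_graph_iff T |>.1 hz
    have := hγ y
    simp only [mem_ofPred_eq, ← hy1, ← hy2]
    exact this
  have hbound : ∀ z ∈ G, (γ - lam) * ‖z.1‖ ≤ ‖L z‖ := fun z hz => by
    have h1 := hform z hz
    have h2 : (inner ℂ z.1 (L z)).re = (inner ℂ z.1 z.2).re - lam * ‖z.1‖ ^ 2 := by
      rw [hLapp, inner_sub_right, inner_smul_right, inner_self_eq_norm_sq_to_K]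
      norm_num [← Complex.ofReal_pow]
    have h3 : (inner ℂ z.1 (L z)).re ≤ ‖z.1‖ * ‖L z‖ :=
      (Complex.re_le_norm _).trans (norm_inner_le_norm _ _)
    rcases (norm_nonneg z.1).eq_or_lt with h0 | h0
    · rw [← h0]; simp
    · refine le_of_mul_le_mul_left ?_ h0
      nlinarith
  -- By `hbound` and `z.2 = L z + lam z.1`, the map `L` is bounded below in the graph norm on the
  -- closed subspace `G`, hence has closed range there.
  have hclosed : _root_.IsClosed (G.map L.toLinearMap : Set H) := by
    have hGc : _root_.IsClosed (G : Set (H × H)) := Submodule.isClosed_topologicalClosure _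
    have : CompleteSpace G := hGc.completeSpace_coe
    let LG : G →L[ℂ] H := L.comp G.subtypeL
    have hγl : 0 < γ - lam := by linarith
    have hanti : AntilipschitzWith (1 + (1 + |lam|) / (γ - lam)).toNNReal LG := by
      refine ContinuousLinearMap.antilipschitz_of_bound LG fun z => ?_
      have hK : 0 ≤ (1 + |lam|) / (γ - lam) := by positivity
      rw [Real.coe_toNNReal _ (by positivity)]
      have hb : ‖z.1.1‖ ≤ ‖LG z‖ / (γ - lam) := by
        rw [le_div_iff₀ hγl, mul_comm]; exact hbound z z.2
      have h2 : ‖z.1.2‖ ≤ ‖LG z‖ + |lam| * ‖z.1.1‖ := by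
        have e : z.1.2 = LG z + (lam : ℂ) • z.1.1 := by
          change _ = L z + _
          rw [hLapp]; abel
        rw [e]
        refine (norm_add_le _ _).trans ?_
        rw [norm_smul]; simp
      have e : (1 + (1 + |lam|) / (γ - lam)) * ‖LG z‖ =
          ‖LG z‖ + ‖LG z‖ / (γ - lam) + |lam| * (‖LG z‖ / (γ - lam)) := by ring
      have h3 : |lam| * ‖z.1.1‖ ≤ |lam| * (‖LG z‖ / (γ - lam)) :=
        mul_le_mul_of_nonneg_left hb (abs_nonneg _)
      have h4 : 0 ≤ |lam| * (‖LG z‖ / (γ - lam)) := by positivity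
      have h5 : 0 ≤ ‖LG z‖ / (γ - lam) := by positivity
      rw [e]
      refine max_le ?_ ?_
      · change ‖z.1.1‖ ≤ _
        linarith [norm_nonneg (LG z)]
      · change ‖z.1.2‖ ≤ _
        linarith
    have := hanti.isClosed_range LG.uniformContinuous
    convert this using 1
    ext x
    simp [LG]
  have hGS : G ≤ S.graph :=
    Submodule.topologicalClosure_minimal _ (LinearPMap.le_graph_of_le hTS) hcl
  have hRG : R.topologicalClosure ≤ G.map L.toLinearMap :=
    Submodule.topologicalClosure_minimal _
      (Submodule.map_mono (Submodule.le_topologicalClosure _)) hclosed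
  let Slam : S.domain →ₗ[ℂ] H := S.toFun - (lam : ℂ) • S.domain.subtype
  -- `D` is the domain of the closure of `T`, where the bound `γ` persists by `hform`. The rest
  -- shows that it has finite codimension.
  let D : Submodule ℂ S.domain := G.comap (S.domain.subtype.prod S.toFun)
  let N : Submodule ℂ S.domain := LinearMap.ker Slam
  have hNfin : FiniteDimensional ℂ N := by
    -- By symmetry, eigenvectors of `S` at the real number `lam` are orthogonal to the range of `T -
    -- lam`.
    have hN : ∀ u ∈ N, (u : H) ∈ Rᗮ := by
      intro u hu
      rw [Submodule.mem_orthogonal]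
      rintro _ ⟨z, hz, rfl⟩
      obtain ⟨y, hy1, hy2⟩ := S.mem_graph_iff.1 (LinearPMap.le_graph_of_le hTS hz)
      have h0 : S u = (lam : ℂ) • (u : H) := sub_eq_zero.1 hu
      change inner ℂ (L z) _ = 0
      rw [hLapp, ← hy1, ← hy2, inner_sub_left, hS y u, h0, inner_smul_left, inner_smul_right]
      simp
    exact FiniteDimensional.of_injective
      ((S.domain.subtype ∘ₗ N.subtype).codRestrict Rᗮ fun u => hN u u.2)
      (fun u v huv => by
        have h := congrArg Subtype.val huv
        exact Subtype.ext (Subtype.ext h))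
  -- If the `Rᗮ` component of `(S - lam) u` vanishes, then `(S - lam) u` lies in the closure of `R`,
  -- hence equals `(S - lam) y` with `y ∈ D`, and `u - y ∈ N`. Thus `D ⊔ N` contains the kernel of a
  -- map into a finite-dimensional space.
  let P : S.domain →ₗ[ℂ] Rᗮ := (Rᗮ.orthogonalProjectionOnto).toLinearMap ∘ₗ Slam
  have hkerP : LinearMap.ker P ≤ D ⊔ N := by
    intro u hu
    have h1 : Slam u ∈ Rᗮᗮ := by
      rw [← Submodule.orthogonalProjectionOnto_eq_zero_iff]
      exact hu
    rw [Submodule.orthogonal_orthogonal_eq_closure] at h1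
    obtain ⟨z, hz, hzu⟩ := hRG h1
    obtain ⟨y, hy1, hy2⟩ := S.mem_graph_iff.1 (hGS hz)
    refine Submodule.mem_sup.2 ⟨y, ?_, u - y, ?_, by abel⟩
    · change ((y : H), S y) ∈ G
      rw [hy1, hy2]
      exact hz
    · refine (LinearMap.mem_ker).2 ?_
      rw [LinearMap.map_sub, ← hzu]
      change L z - (S y - (lam : ℂ) • (y : H)) = 0
      rw [hLapp, hy1, hy2, sub_self]
  have hPco : (LinearMap.ker P).CoFG :=
    Module.Finite.equiv (P.quotKerEquivRange).symm
  have hD : D.CoFG := by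
    obtain ⟨C, hC⟩ := Submodule.exists_isCompl (LinearMap.ker P)
    have hCfin : FiniteDimensional ℂ C :=
      Module.Finite.equiv (Submodule.quotientEquivOfIsCompl _ _ hC)
    have htop : D ⊔ (N ⊔ C) = ⊤ := by
      rw [eq_top_iff, ← hC.sup_eq_top, ← sup_assoc]
      exact sup_le_sup_right hkerP C
    refine Module.Finite.of_surjective (D.mkQ ∘ₗ (N ⊔ C).subtype) fun x => ?_
    obtain ⟨u, rfl⟩ := D.mkQ_surjective x
    obtain ⟨d, hd, w, hw, rfl⟩ := Submodule.mem_sup.1 (htop ▸ Submodule.mem_top : u ∈ D ⊔ (N ⊔ C))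
    refine ⟨⟨w, hw⟩, ?_⟩
    simpa using hd
  exact LinearPMap.bounded_below_of_coFG hS hD fun u hu => hform _ hu

end Abstract

/-! ### Absolutely continuous functions: Lipschitz images, inverses, integration of the derivative.
-/

theorem AbsolutelyContinuousOnInterval.lipschitzOnWith_comp {X Y : Type*} [PseudoMetricSpace X]
    [PseudoMetricSpace Y] {f : ℝ → X} {g : X → Y} {a b : ℝ} {K : NNReal}
    (hf : AbsolutelyContinuousOnInterval f a b) (hg : LipschitzOnWith K g (f '' uIcc a b)) :
    AbsolutelyContinuousOnInterval (fun x => g (f x)) a b := by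
  rw [absolutelyContinuousOnInterval_iff] at hf ⊢
  intro ε hε
  -- `K + 1` instead of `K`, which may be zero.
  obtain ⟨δ, hδ, h⟩ := hf (ε / (K + 1)) (by positivity)
  refine ⟨δ, hδ, fun E hE hEδ => ?_⟩
  calc ∑ i ∈ Finset.range E.1, dist (g (f (E.2 i).1)) (g (f (E.2 i).2))
      ≤ ∑ i ∈ Finset.range E.1, K * dist (f (E.2 i).1) (f (E.2 i).2) :=
        Finset.sum_le_sum fun i hi => hg.dist_le_mul _ (mem_image_of_mem f (hE.1 i hi).1) _
          (mem_image_of_mem f (hE.1 i hi).2)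
    _ = K * ∑ i ∈ Finset.range E.1, dist (f (E.2 i).1) (f (E.2 i).2) := by rw [Finset.mul_sum]
    _ ≤ (K + 1) * ∑ i ∈ Finset.range E.1, dist (f (E.2 i).1) (f (E.2 i).2) := by
        gcongr
        linarith
    _ < (K + 1) * (ε / (K + 1)) := by gcongr; exact h E hE hEδ
    _ = ε := by field_simp

/-- By compactness `1 / f` is bounded by some `C`, so inversion is `C²`-Lipschitz on the image of
`f`. -/
theorem AbsolutelyContinuousOnInterval.inv {f : ℝ → ℝ} {a b : ℝ}
    (hf : AbsolutelyContinuousOnInterval f a b) (h0 : ∀ x ∈ uIcc a b, f x ≠ 0) :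
    AbsolutelyContinuousOnInterval (fun x => (f x)⁻¹) a b := by
  obtain ⟨C, hC⟩ := isCompact_uIcc.exists_bound_of_continuousOn (hf.continuousOn.inv₀ h0)
  have hC0 : 0 ≤ C := (norm_nonneg _).trans (hC a left_mem_uIcc)
  refine hf.lipschitzOnWith_comp (g := fun y : ℝ => y⁻¹) (K := (C ^ 2).toNNReal) ?_
  refine LipschitzOnWith.of_dist_le_mul ?_
  rintro _ ⟨x, hx, rfl⟩ _ ⟨y, hy, rfl⟩
  rw [Real.coe_toNNReal _ (sq_nonneg C), dist_inv_inv₀ (h0 x hx) (h0 y hy), div_eq_mul_inv,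
    mul_inv, mul_comm]
  have h1 := hC x hx
  have h2 := hC y hy
  rw [Pi.inv_apply, norm_inv] at h1 h2
  have : ‖f x‖⁻¹ * ‖f y‖⁻¹ ≤ C ^ 2 := by
    rw [sq]
    exact mul_le_mul h1 h2 (by positivity) hC0
  exact mul_le_mul_of_nonneg_right this dist_nonneg

/-- The fundamental theorem of calculus for an absolutely continuous function with given a.e.
derivative. -/
theorem AbsolutelyContinuousOnInterval.integral_eq_sub_of_ae {f g : ℝ → ℝ} {a b : ℝ}
    (hf : AbsolutelyContinuousOnInterval f a b)
    (hg : ∀ᵐ t, t ∈ uIoc a b → HasDerivAt f (g t) t) :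
    IntervalIntegrable g volume a b ∧ ∫ t in a..b, g t = f b - f a := by
  have h : ∀ᵐ t, t ∈ uIoc a b → deriv f t = g t := by
    filter_upwards [hg] with t ht hm using (ht hm).deriv
  refine ⟨hf.intervalIntegrable_deriv.congr_ae ?_, ?_⟩
  · rwa [Filter.EventuallyEq, ae_restrict_iff' measurableSet_uIoc]
  · rw [← hf.integral_deriv_eq_sub]
    exact intervalIntegral.integral_congr_ae (by filter_upwards [h] with t ht hm using (ht hm).symm)

/-! ### Calculus of locally absolutely continuous functions on the interval. -/

namespace SLExpr

variable {τ : SLExpr}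

theorem measurableSet_I (τ : SLExpr) : MeasurableSet τ.I := τ.isOpen_I.measurableSet

theorem ae_mem_I (τ : SLExpr) : ∀ᵐ x ∂(volume.restrict τ.I), x ∈ τ.I :=
  ae_restrict_mem τ.measurableSet_I

theorem ae_uIcc {P : ℝ → Prop} (h : ∀ᵐ t ∂(volume.restrict τ.I), P t) {x y : ℝ} (hx : x ∈ τ.I)
    (hy : y ∈ τ.I) : ∀ᵐ t, t ∈ uIcc x y → P t := by
  rw [ae_restrict_iff' τ.measurableSet_I] at h
  filter_upwards [h] with t ht hm using ht (τ.uIcc_subset_I hx hy hm)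

theorem ae_uIoc {P : ℝ → Prop} (h : ∀ᵐ t ∂(volume.restrict τ.I), P t) {x y : ℝ} (hx : x ∈ τ.I)
    (hy : y ∈ τ.I) : ∀ᵐ t, t ∈ uIoc x y → P t := by
  filter_upwards [ae_uIcc h hx hy] with t ht hm using ht (uIoc_subset_uIcc hm)

theorem min_mem_I {x y : ℝ} (hx : x ∈ τ.I) (hy : y ∈ τ.I) : min x y ∈ τ.I := by
  rcases min_choice x y with h | h <;> rw [h] <;> assumption

theorem max_mem_I {x y : ℝ} (hx : x ∈ τ.I) (hy : y ∈ τ.I) : max x y ∈ τ.I := by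
  rcases max_choice x y with h | h <;> rw [h] <;> assumption

theorem exists_lt_mem_I {x : ℝ} (hx : x ∈ τ.I) : ∃ y ∈ τ.I, y < x := by
  obtain ⟨ε, hε, hball⟩ := Metric.isOpen_iff.1 τ.isOpen_I x hx
  refine ⟨x - ε / 2, hball ?_, by linarith⟩
  rw [Metric.mem_ball, Real.dist_eq, abs_lt]; constructor <;> linarith

theorem exists_gt_mem_I {x : ℝ} (hx : x ∈ τ.I) : ∃ y ∈ τ.I, x < y := by
  obtain ⟨ε, hε, hball⟩ := Metric.isOpen_iff.1 τ.isOpen_I x hx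
  refine ⟨x + ε / 2, hball ?_, by linarith⟩
  rw [Metric.mem_ball, Real.dist_eq, abs_lt]; constructor <;> linarith

theorem continuousOn_I_of_uIcc {E : Type*} [TopologicalSpace E] {f : ℝ → E}
    (h : ∀ x ∈ τ.I, ∀ y ∈ τ.I, ContinuousOn f (uIcc x y)) : ContinuousOn f τ.I := by
  intro x hx
  obtain ⟨y, hy, hyx⟩ := exists_lt_mem_I hx
  obtain ⟨z, hz, hxz⟩ := exists_gt_mem_I hx
  refine ((h y hy z hz).continuousAt ?_).continuousWithinAt
  rw [uIcc_of_le (hyx.trans hxz).le]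
  exact Icc_mem_nhds hyx hxz

theorem ACLoc.continuousOn_I {E : Type*} [NormedAddCommGroup E] {f : ℝ → E} [NormedSpace ℝ E]
    (hf : τ.ACLoc f) : ContinuousOn f τ.I :=
  continuousOn_I_of_uIcc fun x hx y hy => (hf x hx y hy).continuousOn

theorem intervalIntegrable_of_locallyIntegrableOn {E : Type*} [NormedAddCommGroup E] {g : ℝ → E}
    (hg : LocallyIntegrableOn g τ.I volume) {x y : ℝ} (hx : x ∈ τ.I) (hy : y ∈ τ.I) :
    IntervalIntegrable g volume x y :=
  ((hg.integrableOn_compact_subset (τ.uIcc_subset_I hx hy) isCompact_uIcc).mono_set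
    uIoc_subset_uIcc) |> intervalIntegrable_iff.2

theorem ae_I_of_uIcc {P : ℝ → Prop} (h : ∀ x ∈ τ.I, ∀ y ∈ τ.I, ∀ᵐ t, t ∈ uIcc x y → P t) :
    ∀ᵐ t ∂(volume.restrict τ.I), P t := by
  refine ae_restrict_of_ae_restrict_inter_Ioo fun x y hx hy hxy => ?_
  rw [ae_restrict_iff' (τ.isOpen_I.measurableSet.inter measurableSet_Ioo)]
  filter_upwards [h x hx y hy] with z hz hm
  exact hz (Icc_subset_uIcc (Ioo_subset_Icc_self hm.2))

/-- Primitives are based at a fixed point `z`, while local statements concern `[x, y]`; a compact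
interval containing both lets the facts about interval integrals be applied. -/
theorem exists_uIcc_of_mem_I {x y z : ℝ} (hx : x ∈ τ.I) (hy : y ∈ τ.I) (hz : z ∈ τ.I) :
    ∃ b₁ ∈ τ.I, ∃ b₂ ∈ τ.I, z ∈ uIcc b₁ b₂ ∧ uIcc x y ⊆ uIcc b₁ b₂ := by
  refine ⟨min z (min x y), min_mem_I hz (min_mem_I hx hy), max z (max x y),
    max_mem_I hz (max_mem_I hx hy), ?_, ?_⟩
  · exact Icc_subset_uIcc ⟨min_le_left _ _, le_max_left _ _⟩
  · refine (Icc_subset_Icc ?_ ?_).trans Icc_subset_uIcc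
    · exact min_le_right _ _
    · exact le_max_right _ _

/-- `f` is locally absolutely continuous on `(a, b)` with derivative `g` almost everywhere. -/
def HasACDeriv (τ : SLExpr) (f g : ℝ → ℝ) : Prop :=
  τ.ACLoc f ∧ ∀ᵐ t ∂(volume.restrict τ.I), HasDerivAt f (g t) t

theorem ACLoc.hasACDeriv_deriv {f : ℝ → ℝ} (hf : τ.ACLoc f) : τ.HasACDeriv f (deriv f) := by
  refine ⟨hf, ae_I_of_uIcc fun x hx y hy => ?_⟩
  filter_upwards [(hf x hx y hy).ae_differentiableAt] with t ht hm using (ht hm).hasDerivAt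

namespace HasACDeriv

variable {f f' g g' : ℝ → ℝ}

theorem acLoc (hf : τ.HasACDeriv f f') : τ.ACLoc f := hf.1

theorem ae_deriv_eq (hf : τ.HasACDeriv f f') :
    ∀ᵐ t ∂(volume.restrict τ.I), deriv f t = f' t := by
  filter_upwards [hf.2] with t ht using ht.deriv

theorem continuousOn (hf : τ.HasACDeriv f f') : ContinuousOn f τ.I := hf.1.continuousOn_I

theorem congr (hf : τ.HasACDeriv f f') (h : ∀ᵐ t ∂(volume.restrict τ.I), f' t = g' t) :
    τ.HasACDeriv f g' := by
  refine ⟨hf.1, ?_⟩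
  filter_upwards [hf.2, h] with t h1 h2
  rwa [← h2]

theorem add (hf : τ.HasACDeriv f f') (hg : τ.HasACDeriv g g') :
    τ.HasACDeriv (fun t => f t + g t) (fun t => f' t + g' t) := by
  refine ⟨fun x hx y hy => (hf.1 x hx y hy).fun_add (hg.1 x hx y hy), ?_⟩
  filter_upwards [hf.2, hg.2] with t h1 h2 using h1.add h2

theorem sub (hf : τ.HasACDeriv f f') (hg : τ.HasACDeriv g g') :
    τ.HasACDeriv (fun t => f t - g t) (fun t => f' t - g' t) := by
  refine ⟨fun x hx y hy => (hf.1 x hx y hy).fun_sub (hg.1 x hx y hy), ?_⟩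
  filter_upwards [hf.2, hg.2] with t h1 h2 using h1.sub h2

theorem mul (hf : τ.HasACDeriv f f') (hg : τ.HasACDeriv g g') :
    τ.HasACDeriv (fun t => f t * g t) (fun t => f' t * g t + f t * g' t) := by
  refine ⟨fun x hx y hy => (hf.1 x hx y hy).fun_mul (hg.1 x hx y hy), ?_⟩
  filter_upwards [hf.2, hg.2] with t h1 h2 using h1.mul h2

theorem intervalIntegrable (hf : τ.HasACDeriv f f') {x y : ℝ} (hx : x ∈ τ.I) (hy : y ∈ τ.I) :
    IntervalIntegrable f' volume x y :=
  ((hf.1 x hx y hy).integral_eq_sub_of_ae (ae_uIoc hf.2 hx hy)).1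

theorem integral_eq_sub (hf : τ.HasACDeriv f f') {x y : ℝ} (hx : x ∈ τ.I) (hy : y ∈ τ.I) :
    ∫ t in x..y, f' t = f y - f x :=
  ((hf.1 x hx y hy).integral_eq_sub_of_ae (ae_uIoc hf.2 hx hy)).2

end HasACDeriv

theorem hasACDeriv_const (τ : SLExpr) (C : ℝ) : τ.HasACDeriv (fun _ => C) (fun _ => 0) :=
  ⟨fun _ _ _ _ => (LipschitzWith.const C).lipschitzOnWith.absolutelyContinuousOnInterval,
    Filter.Eventually.of_forall fun t => hasDerivAt_const t C⟩

theorem hasACDeriv_primitive {g : ℝ → ℝ} (hg : LocallyIntegrableOn g τ.I volume) {c : ℝ}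
    (hc : c ∈ τ.I) : τ.HasACDeriv (fun t => ∫ s in c..t, g s) g := by
  constructor
  · intro x hx y hy
    obtain ⟨b₁, h₁, b₂, h₂, hcb, hsub⟩ := exists_uIcc_of_mem_I hx hy hc
    exact ((intervalIntegrable_of_locallyIntegrableOn hg h₁
      h₂).absolutelyContinuousOnInterval_intervalIntegral hcb).mono hsub
  · refine ae_I_of_uIcc fun x hx y hy => ?_
    obtain ⟨b₁, h₁, b₂, h₂, hcb, hsub⟩ := exists_uIcc_of_mem_I hx hy hc
    filter_upwards [(intervalIntegrable_of_locallyIntegrableOn hg h₁ h₂).ae_hasDerivAt_integral]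
      with t ht hm using ht (hsub hm) c hcb

theorem continuousOn_primitive_I {E : Type*} [NormedAddCommGroup E] [NormedSpace ℝ E] {g : ℝ → E}
    (hg : LocallyIntegrableOn g τ.I volume) {c : ℝ} (hc : c ∈ τ.I) :
    ContinuousOn (fun t => ∫ s in c..t, g s) τ.I := by
  refine continuousOn_I_of_uIcc fun x hx y hy => ?_
  obtain ⟨b₁, h₁, b₂, h₂, hcb, hsub⟩ := exists_uIcc_of_mem_I hx hy hc
  exact (intervalIntegral.continuousOn_primitive_interval'
    (intervalIntegrable_of_locallyIntegrableOn hg h₁ h₂) hcb).mono hsub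

theorem HasACDeriv.pow {f f' : ℝ → ℝ} (hf : τ.HasACDeriv f f') (n : ℕ) :
    τ.HasACDeriv (fun t => f t ^ (n + 1)) (fun t => (n + 1) * (f t ^ n * f' t)) := by
  induction n with
  | zero => simpa using hf
  | succ n ih =>
    have := ih.mul hf
    simp only [← pow_succ] at this
    refine this.congr (Filter.Eventually.of_forall fun t => ?_)
    push_cast
    ring

/-! ### Linear differential equations with locally integrable coefficients. -/

section LinearODE

variable {E : Type*} [NormedAddCommGroup E] [NormedSpace ℝ E]

/-- The Picard iterates of the linear equation `y' = B y`, `y x₀ = e`. -/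
noncomputable def picardIterate (B : ℝ → E →L[ℝ] E) (x₀ : ℝ) (e : E) : ℕ → ℝ → E
  | 0 => fun _ => e
  | n + 1 => fun t => ∫ s in x₀..t, B s (picardIterate B x₀ e n s)

variable {B : ℝ → E →L[ℝ] E} {β : ℝ → ℝ} {x₀ : ℝ} {e : E}

/-- Local integrability of `B y` for every continuous `y` replaces any measurability assumption on
the operator-valued function `B`. -/
theorem continuousOn_picardIterate
    (hB : ∀ y : ℝ → E, ContinuousOn y τ.I → LocallyIntegrableOn (fun t => B t (y t)) τ.I volume)
    (hx₀ : x₀ ∈ τ.I) (n : ℕ) : ContinuousOn (picardIterate B x₀ e n) τ.I := by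
  induction n with
  | zero => exact continuousOn_const
  | succ n ih => exact continuousOn_primitive_I (hB _ ih) hx₀

/-- Since `β ≥ 0`, the primitive `Φ` of `β` has constant sign on each side of `x₀`, so up to sign
the integrand is the derivative of `Φ ^ (n + 1) / (n + 1)`. The factor `1 / (n + 1)` produces the
factorials in the bound on the iterates. -/
theorem abs_integral_mul_abs_pow_le (hβ : LocallyIntegrableOn β τ.I volume) (hβ0 : ∀ t, 0 ≤ β t)
    (hx₀ : x₀ ∈ τ.I) {t : ℝ} (ht : t ∈ τ.I) (n : ℕ) :
    |∫ s in x₀..t, |∫ v in x₀..s, β v| ^ n * β s| ≤ |∫ v in x₀..t, β v| ^ (n + 1) / (n + 1) := by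
  set Φ : ℝ → ℝ := fun t => ∫ s in x₀..t, β s with hΦ
  have hAC : τ.HasACDeriv Φ β := hasACDeriv_primitive hβ hx₀
  obtain ⟨ε, hε, hsign⟩ : ∃ ε : ℝ, |ε| = 1 ∧ ∀ s ∈ uIcc x₀ t, |Φ s| = ε * Φ s := by
    rcases le_total x₀ t with h | h
    · refine ⟨1, by simp, fun s hs => ?_⟩
      rw [uIcc_of_le h] at hs
      rw [one_mul, abs_of_nonneg (intervalIntegral.integral_nonneg hs.1 fun v _ => hβ0 v)]
    · refine ⟨-1, by simp, fun s hs => ?_⟩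
      rw [uIcc_of_ge h] at hs
      rw [neg_one_mul, abs_of_nonpos]
      simp only [hΦ]
      rw [intervalIntegral.integral_symm]
      exact neg_nonpos.2 (intervalIntegral.integral_nonneg hs.2 fun v _ => hβ0 v)
  have h1 : ∫ s in x₀..t, |Φ s| ^ n * β s = ε ^ n * ∫ s in x₀..t, Φ s ^ n * β s := by
    rw [← intervalIntegral.integral_const_mul]
    refine intervalIntegral.integral_congr fun s hs => ?_
    simp only [hsign s hs, mul_pow, mul_assoc]
  have h2 := (hAC.pow n).integral_eq_sub hx₀ ht
  rw [intervalIntegral.integral_const_mul] at h2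
  have h3 : Φ x₀ = 0 := intervalIntegral.integral_same
  have h4 : ∫ s in x₀..t, Φ s ^ n * β s = Φ t ^ (n + 1) / (n + 1) := by
    rw [eq_div_iff (by positivity), mul_comm, h2, h3]
    simp
  change |∫ s in x₀..t, |Φ s| ^ n * β s| ≤ _
  rw [h1, h4, abs_mul, abs_pow, hε, one_pow, one_mul, abs_div, abs_pow,
    abs_of_pos (by positivity : (0 : ℝ) < n + 1)]

theorem norm_picardIterate_le (hβ : LocallyIntegrableOn β τ.I volume) (hBβ : ∀ t, ‖B t‖ ≤ β t)
    (hx₀ : x₀ ∈ τ.I) (n : ℕ) {t : ℝ} (ht : t ∈ τ.I) :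
    ‖picardIterate B x₀ e n t‖ ≤ ‖e‖ * (|∫ v in x₀..t, β v| ^ n / n.factorial) := by
  have hβ0 : ∀ t, 0 ≤ β t := fun t => (norm_nonneg _).trans (hBβ t)
  induction n generalizing t with
  | zero => simp [picardIterate]
  | succ n ih =>
    have hΦ : ContinuousOn (fun t => |∫ v in x₀..t, β v| ^ n) τ.I :=
      ((continuousOn_primitive_I hβ hx₀).abs).pow n
    have hint : IntervalIntegrable (fun s => |∫ v in x₀..s, β v| ^ n * β s) volume x₀ t :=
      intervalIntegrable_of_locallyIntegrableOn
        (hβ.continuousOn_mul hΦ τ.isOpen_I.isLocallyClosed) hx₀ ht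
    refine (intervalIntegral.norm_integral_le_abs_of_norm_le
      (g := fun s => ‖e‖ / n.factorial * (|∫ v in x₀..s, β v| ^ n * β s)) ?_
      (hint.const_mul _)).trans ?_
    · rw [ae_restrict_iff' measurableSet_uIoc]
      refine Filter.Eventually.of_forall fun s hs => ?_
      have hs' : s ∈ τ.I := τ.uIcc_subset_I hx₀ ht (uIoc_subset_uIcc hs)
      refine ((B s).le_opNorm _).trans ?_
      calc ‖B s‖ * ‖picardIterate B x₀ e n s‖
          ≤ β s * (‖e‖ * (|∫ v in x₀..s, β v| ^ n / n.factorial)) :=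
            mul_le_mul (hBβ s) (ih hs') (norm_nonneg _) (hβ0 s)
        _ = _ := by ring
    · rw [intervalIntegral.integral_const_mul, abs_mul, abs_of_nonneg (by positivity)]
      calc _ ≤ ‖e‖ / n.factorial * (|∫ v in x₀..t, β v| ^ (n + 1) / (n + 1)) :=
            mul_le_mul_of_nonneg_left (abs_integral_mul_abs_pow_le hβ hβ0 hx₀ ht n) (by positivity)
        _ = _ := by
          rw [Nat.factorial_succ]
          push_cast
          field_simp

variable [CompleteSpace E]

/-- Global existence for linear differential equations with locally integrable coefficients. -/
theorem exists_linear_ode_solution (hβ : LocallyIntegrableOn β τ.I volume)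
    (hBβ : ∀ t, ‖B t‖ ≤ β t)
    (hB : ∀ y : ℝ → E, ContinuousOn y τ.I → LocallyIntegrableOn (fun t => B t (y t)) τ.I volume)
    (hx₀ : x₀ ∈ τ.I) (e : E) :
    ∃ y : ℝ → E, ContinuousOn y τ.I ∧ ∀ t ∈ τ.I, y t = e + ∫ s in x₀..t, B s (y s) := by
  set Y := picardIterate B x₀ e with hY
  have hYc := continuousOn_picardIterate (e := e) hB hx₀
  have hloc : ∀ x ∈ τ.I, ∀ z ∈ τ.I, ∃ C : ℝ, 0 ≤ C ∧
      ∀ n, ∀ s ∈ uIcc x z, ‖Y n s‖ ≤ ‖e‖ * (C ^ n / n.factorial) := by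
    intro x hx z hz
    have hsub := τ.uIcc_subset_I hx hz
    obtain ⟨C, hC⟩ := isCompact_uIcc.exists_bound_of_continuousOn
      ((continuousOn_primitive_I hβ hx₀).mono hsub)
    refine ⟨C, (norm_nonneg _).trans (hC x left_mem_uIcc), fun n s hs => ?_⟩
    refine (norm_picardIterate_le hβ hBβ hx₀ n (hsub hs)).trans ?_
    have := hC s hs
    rw [Real.norm_eq_abs] at this
    gcongr
  have hsummable : ∀ C : ℝ, Summable fun n : ℕ => ‖e‖ * (C ^ n / n.factorial) := fun C =>
    (Real.summable_pow_div_factorial C).mul_left _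
  have hYsum : ∀ t ∈ τ.I, Summable fun n => Y n t := fun t ht => by
    obtain ⟨C, _, hC⟩ := hloc t ht t ht
    exact Summable.of_norm_bounded (hsummable C) fun n => hC n t left_mem_uIcc
  -- The `Y n` are increments rather than successive approximations: each is the integral of `B`
  -- applied to the previous one, so the solution is their sum, dominated by an exponential series
  -- on compact intervals.
  refine ⟨fun t => ∑' n, Y n t, ?_, fun t ht => ?_⟩
  · refine continuousOn_I_of_uIcc fun x hx z hz => ?_
    obtain ⟨C, _, hC⟩ := hloc x hx z hz
    exact continuousOn_tsum (fun n => (hYc n).mono (τ.uIcc_subset_I hx hz)) (hsummable C) hC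
  · have hsub := τ.uIcc_subset_I hx₀ ht
    obtain ⟨C, hC0, hC⟩ := hloc x₀ hx₀ t ht
    have hint : HasSum (fun n => ∫ s in x₀..t, B s (Y n s)) (∫ s in x₀..t, B s (∑' n, Y n s)) := by
      refine intervalIntegral.hasSum_integral_of_dominated_convergence
        (fun n s => β s * (‖e‖ * (C ^ n / n.factorial))) (fun n => ?_) (fun n => ?_) ?_ ?_ ?_
      · exact (intervalIntegrable_iff.1
          (intervalIntegrable_of_locallyIntegrableOn (hB _ (hYc n)) hx₀ ht)).aestronglyMeasurable
      · refine Filter.Eventually.of_forall fun s hs => ((B s).le_opNorm _).trans ?_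
        exact mul_le_mul (hBβ s) (hC n s (uIoc_subset_uIcc hs)) (norm_nonneg _)
          ((norm_nonneg _).trans (hBβ s))
      · exact Filter.Eventually.of_forall fun s _ => (hsummable C).mul_left _
      · simp_rw [tsum_mul_left]
        exact (intervalIntegrable_of_locallyIntegrableOn hβ hx₀ ht).mul_const _
      · exact Filter.Eventually.of_forall fun s hs =>
          (B s).hasSum (hYsum s (hsub (uIoc_subset_uIcc hs))).hasSum
    beta_reduce
    rw [(hYsum t ht).tsum_eq_zero_add, ← hint.tsum_eq]
    rfl

end LinearODE

/-- The solutions of the initial value problem for `τ u = lam u`, as a first order system. -/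
theorem exists_solution (hτ : τ.Hypothesis) (lam : ℝ) {x₀ : ℝ} (hx₀ : x₀ ∈ τ.I) (e₀ e₁ : ℝ) :
    ∃ u u₁ : ℝ → ℝ, τ.HasACDeriv u (fun t => (τ.p t)⁻¹ * u₁ t - τ.s t * u t) ∧
      τ.HasACDeriv u₁ (fun t => τ.s t * u₁ t + (τ.q t - lam * τ.r t) * u t) ∧
      u x₀ = e₀ ∧ u₁ x₀ = e₁ := by
  let fst := ContinuousLinearMap.fst ℝ ℝ ℝ
  let snd := ContinuousLinearMap.snd ℝ ℝ ℝ
  let B : ℝ → ℝ × ℝ →L[ℝ] ℝ × ℝ := fun t =>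
    ((τ.p t)⁻¹ • snd - τ.s t • fst).prod (τ.s t • snd + (τ.q t - lam * τ.r t) • fst)
  have hBapp : ∀ t z, B t z = ((τ.p t)⁻¹ * z.2 - τ.s t * z.1,
    τ.s t * z.2 + (τ.q t - lam * τ.r t) * z.1) := fun t z => rfl
  have hqr : LocallyIntegrableOn (fun t => τ.q t - lam * τ.r t) τ.I volume :=
    hτ.q_loc.sub (hτ.r_loc.smul lam)
  let β : ℝ → ℝ := fun t => ‖(τ.p t)⁻¹‖ + ‖τ.s t‖ + ‖τ.q t - lam * τ.r t‖
  have hβ : LocallyIntegrableOn β τ.I volume :=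
    (hτ.p_inv_loc.norm.add hτ.s_loc.norm).add hqr.norm
  have hBβ : ∀ t, ‖B t‖ ≤ β t := by
    intro t
    refine ContinuousLinearMap.opNorm_le_bound _ (by positivity) fun z => ?_
    rw [hBapp]
    have h1 : ‖z.1‖ ≤ ‖z‖ := norm_fst_le z
    have h2 : ‖z.2‖ ≤ ‖z‖ := norm_snd_le z
    refine max_le ?_ ?_
    · refine (norm_sub_le _ _).trans ?_
      rw [norm_mul, norm_mul, add_mul, add_mul]
      have := mul_le_mul_of_nonneg_left h2 (norm_nonneg (τ.p t)⁻¹)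
      have := mul_le_mul_of_nonneg_left h1 (norm_nonneg (τ.s t))
      have : 0 ≤ ‖τ.q t - lam * τ.r t‖ * ‖z‖ := by positivity
      linarith
    · refine (norm_add_le _ _).trans ?_
      rw [norm_mul, norm_mul, add_mul, add_mul]
      have := mul_le_mul_of_nonneg_left h1 (norm_nonneg (τ.q t - lam * τ.r t))
      have := mul_le_mul_of_nonneg_left h2 (norm_nonneg (τ.s t))
      have : 0 ≤ ‖(τ.p t)⁻¹‖ * ‖z‖ := by positivity
      linarith
  have hcomp : ∀ y : ℝ → ℝ × ℝ, ContinuousOn y τ.I →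
      LocallyIntegrableOn (fun t => (τ.p t)⁻¹ * (y t).2 - τ.s t * (y t).1) τ.I volume ∧
      LocallyIntegrableOn (fun t => τ.s t * (y t).2 + (τ.q t - lam * τ.r t) * (y t).1)
        τ.I volume := by
    intro y hy
    have h1 := hy.fst
    have h2 := hy.snd
    have ho := τ.isOpen_I.isLocallyClosed
    exact ⟨(hτ.p_inv_loc.mul_continuousOn h2 ho).sub (hτ.s_loc.mul_continuousOn h1 ho),
      (hτ.s_loc.mul_continuousOn h2 ho).add (hqr.mul_continuousOn h1 ho)⟩
  have hB : ∀ y : ℝ → ℝ × ℝ, ContinuousOn y τ.I →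
      LocallyIntegrableOn (fun t => B t (y t)) τ.I volume := by
    intro y hy x hx
    obtain ⟨s, hs, hs'⟩ := (hcomp y hy).1 x hx
    obtain ⟨s₂, hs₂, hs₂'⟩ := (hcomp y hy).2 x hx
    refine ⟨s ∩ s₂, Filter.inter_mem hs hs₂, ?_⟩
    exact (hs'.mono_set inter_subset_left).prodMk (hs₂'.mono_set inter_subset_right)
  obtain ⟨y, hyc, hy⟩ := exists_linear_ode_solution hβ hBβ hB hx₀ (e₀, e₁)
  obtain ⟨hg1, hg2⟩ := hcomp y hyc
  have hfst : ∀ t ∈ τ.I, (y t).1 = e₀ + ∫ s in x₀..t, ((τ.p s)⁻¹ * (y s).2 - τ.s s * (y s).1) := by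
    intro t ht
    have := fst.intervalIntegral_comp_comm
      (intervalIntegrable_of_locallyIntegrableOn (hB y hyc) hx₀ ht)
    rw [hy t ht, Prod.fst_add]
    exact congrArg (e₀ + ·) this.symm
  have hsnd : ∀ t ∈ τ.I, (y t).2 =
      e₁ + ∫ s in x₀..t, (τ.s s * (y s).2 + (τ.q s - lam * τ.r s) * (y s).1) := by
    intro t ht
    have := snd.intervalIntegral_comp_comm
      (intervalIntegrable_of_locallyIntegrableOn (hB y hyc) hx₀ ht)
    rw [hy t ht, Prod.snd_add]
    exact congrArg (e₁ + ·) this.symm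
  -- The integral equations hold only on `τ.I`, so the solution returned consists of the right-hand
  -- sides, which agree there with the components of `y`.
  have hd1 := (τ.hasACDeriv_const e₀).add (hasACDeriv_primitive hg1 hx₀)
  have hd2 := (τ.hasACDeriv_const e₁).add (hasACDeriv_primitive hg2 hx₀)
  refine ⟨_, _, hd1.congr ?_, hd2.congr ?_, by simp, by simp⟩
  · filter_upwards [τ.ae_mem_I] with t ht
    rw [← hfst t ht, ← hsnd t ht, zero_add]
  · filter_upwards [τ.ae_mem_I] with t ht
    rw [← hfst t ht, ← hsnd t ht, zero_add]

/-! ### Quasi-derivatives under real-linear maps, and the equivalent first order system. -/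

section Components

variable {E F : Type*} [NormedAddCommGroup E] [NormedSpace ℝ E] [NormedAddCommGroup F]
  [NormedSpace ℝ F]

theorem ACLoc.ae_differentiableAt_of_finiteDimensional [FiniteDimensional ℝ E] {f : ℝ → E}
    (hf : τ.ACLoc f) : ∀ᵐ x ∂(volume.restrict τ.I), DifferentiableAt ℝ f x :=
  ae_I_of_uIcc fun x hx y hy => (hf x hx y hy).boundedVariationOn.ae_differentiableAt_of_mem_uIcc

theorem ACLoc.clm_comp {f : ℝ → E} (hf : τ.ACLoc f) (L : E →L[ℝ] F) :
    τ.ACLoc (fun t => L (f t)) := fun x hx y hy =>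
  (hf x hx y hy).lipschitzOnWith_comp L.lipschitz.lipschitzOnWith

theorem HasQuasiDeriv.clm_comp [FiniteDimensional ℝ E] {f f₁ : ℝ → E}
    (hf : τ.HasQuasiDeriv f f₁) (L : E →L[ℝ] F) :
    τ.HasQuasiDeriv (fun t => L (f t)) (fun t => L (f₁ t)) := by
  refine ⟨hf.acLoc.clm_comp L, hf.acLoc_quasi.clm_comp L, ?_⟩
  filter_upwards [hf.eq_ae, hf.acLoc.ae_differentiableAt_of_finiteDimensional] with t h1 h2
  have h3 : HasDerivAt (fun t => L (f t)) (L (deriv f t)) t := L.hasFDerivAt.comp_hasDerivAt t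
    h2.hasDerivAt
  rw [h3.deriv, h1]
  simp

theorem apply_clm_comp [FiniteDimensional ℝ E] {f f₁ : ℝ → E} (hf : τ.ACLoc f₁) (L : E →L[ℝ] F) :
    ∀ᵐ t ∂(volume.restrict τ.I),
      τ.apply (fun t => L (f t)) (fun t => L (f₁ t)) t = L (τ.apply f f₁ t) := by
  filter_upwards [hf.ae_differentiableAt_of_finiteDimensional] with t h2
  have h3 : HasDerivAt (fun t => L (f₁ t)) (L (deriv f₁ t)) t := L.hasFDerivAt.comp_hasDerivAt t
    h2.hasDerivAt
  simp only [apply]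
  rw [h3.deriv]
  simp

end Components

theorem HasQuasiDeriv.hasACDeriv (hτ : τ.Hypothesis) {g g₁ : ℝ → ℝ} (hg : τ.HasQuasiDeriv g g₁) :
    τ.HasACDeriv g (fun t => (τ.p t)⁻¹ * g₁ t - τ.s t * g t) := by
  refine hg.acLoc.hasACDeriv_deriv.congr ?_
  filter_upwards [hg.eq_ae, hτ.p_ne] with t h1 h2
  rw [h1, smul_eq_mul, smul_eq_mul, inv_mul_cancel_left₀ h2]
  ring

theorem HasACDeriv.hasQuasiDeriv (hτ : τ.Hypothesis) {u u₁ u₁' : ℝ → ℝ}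
    (hu : τ.HasACDeriv u (fun t => (τ.p t)⁻¹ * u₁ t - τ.s t * u t)) (hu₁ : τ.HasACDeriv u₁ u₁') :
    τ.HasQuasiDeriv u u₁ := by
  refine ⟨hu.acLoc, hu₁.acLoc, ?_⟩
  filter_upwards [hu.ae_deriv_eq, hτ.p_ne] with t h1 h2
  rw [h1, smul_eq_mul, smul_eq_mul, sub_add_cancel, mul_inv_cancel_left₀ h2]

theorem isRealSolution_of_hasACDeriv (hτ : τ.Hypothesis) {lam : ℝ} {u u₁ : ℝ → ℝ}
    (hu : τ.HasACDeriv u (fun t => (τ.p t)⁻¹ * u₁ t - τ.s t * u t))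
    (hu₁ : τ.HasACDeriv u₁ (fun t => τ.s t * u₁ t + (τ.q t - lam * τ.r t) * u t)) :
    τ.IsRealSolution lam u := by
  refine ⟨u₁, hu.hasQuasiDeriv hτ hu₁, ?_⟩
  filter_upwards [hu₁.ae_deriv_eq] with t h1
  rw [h1]
  ring

/-! ### Riccati inequalities and the positivity of the quadratic form. -/

/-- The density of the quadratic form of `τ - γ`. -/
noncomputable def formDensity (τ : SLExpr) (γ : ℝ) (g g₁ : ℝ → ℝ) (t : ℝ) : ℝ :=
  (τ.p t)⁻¹ * g₁ t ^ 2 + τ.q t * g t ^ 2 - γ * (τ.r t * g t ^ 2)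

theorem locallyIntegrableOn_formDensity (hτ : τ.Hypothesis) (γ : ℝ) {g g₁ : ℝ → ℝ}
    (hg : ContinuousOn g τ.I) (hg₁ : ContinuousOn g₁ τ.I) :
    LocallyIntegrableOn (τ.formDensity γ g g₁) τ.I volume := by
  have ho := τ.isOpen_I.isLocallyClosed
  exact ((hτ.p_inv_loc.mul_continuousOn (hg₁.pow 2) ho).add
    (hτ.q_loc.mul_continuousOn (hg.pow 2) ho)).sub
    ((hτ.r_loc.mul_continuousOn (hg.pow 2) ho).smul γ)

/-- `φ` is absolutely continuous on `[x, y]` and satisfies the Riccati inequality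
`φ' ≤ 2 s φ + q - φ² / p - γ r` there. -/
def RiccatiLE (τ : SLExpr) (γ : ℝ) (φ : ℝ → ℝ) (x y : ℝ) : Prop :=
  AbsolutelyContinuousOnInterval φ x y ∧ ∀ᵐ t, t ∈ uIcc x y → ∃ φ', HasDerivAt φ φ' t ∧
    φ' ≤ 2 * τ.s t * φ t + τ.q t - (τ.p t)⁻¹ * φ t ^ 2 - γ * τ.r t

/-- Since `r > 0`, lowering `γ` raises the right-hand side. This is what allows functions obtained
for different spectral parameters to be used with one common `γ`. -/
theorem RiccatiLE.mono (hτ : τ.Hypothesis) {γ γ' : ℝ} {φ : ℝ → ℝ} {x y : ℝ}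
    (h : τ.RiccatiLE γ φ x y) (hx : x ∈ τ.I) (hy : y ∈ τ.I) (hγ : γ' ≤ γ) :
    τ.RiccatiLE γ' φ x y := by
  refine ⟨h.1, ?_⟩
  filter_upwards [h.2, ae_uIcc hτ.r_pos hx hy] with t h1 h2 hm
  obtain ⟨φ', h3, h4⟩ := h1 hm
  refine ⟨φ', h3, h4.trans ?_⟩
  have := mul_le_mul_of_nonneg_right hγ (h2 hm).le
  linarith

/-- Picone's inequality. -/
theorem RiccatiLE.sub_le_integral (hτ : τ.Hypothesis)
    (hp : ∀ᵐ x ∂(volume.restrict τ.I), 0 < τ.p x) {γ : ℝ} {φ : ℝ → ℝ} {x y : ℝ}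
    (h : τ.RiccatiLE γ φ x y) (hx : x ∈ τ.I) (hy : y ∈ τ.I) (hxy : x ≤ y) {g g₁ : ℝ → ℝ}
    (hg : τ.HasQuasiDeriv g g₁) :
    φ y * g y ^ 2 - φ x * g x ^ 2 ≤ ∫ t in x..y, τ.formDensity γ g g₁ t := by
  have hg' := hg.hasACDeriv hτ
  have hAC : AbsolutelyContinuousOnInterval (fun t => φ t * g t ^ 2) x y := by
    simp only [sq]
    exact h.1.fun_mul ((hg.acLoc x hx y hy).fun_mul (hg.acLoc x hx y hy))
  rw [← hAC.integral_deriv_eq_sub]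
  refine intervalIntegral.integral_mono_ae_restrict hxy hAC.intervalIntegrable_deriv
    (intervalIntegrable_of_locallyIntegrableOn (locallyIntegrableOn_formDensity hτ γ
      hg.acLoc.continuousOn_I hg.acLoc_quasi.continuousOn_I) hx hy) ?_
  rw [Filter.EventuallyLE, ae_restrict_iff' measurableSet_Icc]
  filter_upwards [h.2, ae_uIcc hg'.2 hx hy, ae_uIcc hp hx hy] with t h1 h2 h3 hm
  rw [← uIcc_of_le hxy] at hm
  obtain ⟨φ', hφ', hle⟩ := h1 hm
  have hd := hφ'.mul ((h2 hm).pow 2)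
  have hinv : 0 < (τ.p t)⁻¹ := inv_pos.2 (h3 hm)
  rw [show deriv (fun t => φ t * g t ^ 2) t = _ from hd.deriv]
  have h4 := mul_le_mul_of_nonneg_right hle (sq_nonneg (g t))
  -- The completed square: with `g' = g₁ / p - s g`, the terms in `s` cancel and this is what the
  -- density exceeds the Riccati bound for `(φ g²)'` by.
  have h5 : 0 ≤ (τ.p t)⁻¹ * (g₁ t - φ t * g t) ^ 2 := by positivity
  simp only [formDensity]
  norm_num
  linarith

/-- The logarithmic quasi-derivative `u₁ / u` satisfies the Riccati equation with equality. -/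
theorem riccatiLE_of_solution {lam : ℝ} {u u₁ : ℝ → ℝ}
    (hu : τ.HasACDeriv u (fun t => (τ.p t)⁻¹ * u₁ t - τ.s t * u t))
    (hu₁ : τ.HasACDeriv u₁ (fun t => τ.s t * u₁ t + (τ.q t - lam * τ.r t) * u t))
    {x y : ℝ} (hx : x ∈ τ.I) (hy : y ∈ τ.I) (h0 : ∀ t ∈ uIcc x y, u t ≠ 0) :
    τ.RiccatiLE lam (fun t => u₁ t * (u t)⁻¹) x y := by
  refine ⟨(hu₁.acLoc x hx y hy).fun_mul ((hu.acLoc x hx y hy).inv h0), ?_⟩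
  filter_upwards [ae_uIcc hu.2 hx hy, ae_uIcc hu₁.2 hx hy] with t h1 h2 hm
  refine ⟨_, (h2 hm).mul ((h1 hm).inv (h0 t hm)), le_of_eq ?_⟩
  have := h0 t hm
  generalize (τ.p t)⁻¹ = P
  field_simp
  ring

/-- On a compact interval, the Riccati inequality for sufficiently negative `γ` has a solution with
prescribed values at both endpoints. -/
theorem exists_riccatiLE (hτ : τ.Hypothesis) {c d : ℝ} (hc : c ∈ τ.I) (hd : d ∈ τ.I) (hcd : c < d)
    (α β : ℝ) : ∃ (γ : ℝ) (φ : ℝ → ℝ), τ.RiccatiLE γ φ c d ∧ φ c = α ∧ φ d = β := by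
  -- `M` will bound `|φ|`, and `G` dominates every term of the Riccati inequality except `-γ r` when
  -- `|φ| ≤ M`. With `γ = -n` it therefore suffices that `φ' ≤ n r - G`.
  set M : ℝ := |α| + |β - α| + 2 with hM
  have hM0 : 0 ≤ M := by positivity
  set G : ℝ → ℝ := fun t => M ^ 2 * ‖(τ.p t)⁻¹‖ + 2 * M * ‖τ.s t‖ + ‖τ.q t‖ with hG
  have hG0 : ∀ t, 0 ≤ G t := fun t => by positivity
  have hGloc : LocallyIntegrableOn G τ.I volume :=
    ((hτ.p_inv_loc.norm.smul (M ^ 2)).add (hτ.s_loc.norm.smul (2 * M))).add hτ.q_loc.norm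
  have hψloc : ∀ n : ℕ, LocallyIntegrableOn (fun t => n * τ.r t - G t) τ.I volume := fun n =>
    (hτ.r_loc.smul (n : ℝ)).sub hGloc
  have hposloc : ∀ n : ℕ, LocallyIntegrableOn (fun t => max (n * τ.r t - G t) 0) τ.I volume :=
    fun n x hx => (hψloc n x hx).imp fun s hs => ⟨hs.1, hs.2.pos_part⟩
  have hnegloc : ∀ n : ℕ, LocallyIntegrableOn (fun t => max (-(n * τ.r t - G t)) 0) τ.I volume :=
    fun n x hx => (hψloc n x hx).imp fun s hs => ⟨hs.1, hs.2.neg_part⟩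
  have hII : ∀ {g : ℝ → ℝ}, LocallyIntegrableOn g τ.I volume → IntervalIntegrable g volume c d :=
    fun h => intervalIntegrable_of_locallyIntegrableOn h hc hd
  have hr := ae_uIoc hτ.r_pos hc hd
  -- As `r > 0` a.e., the negative part of `n r - G` is eventually zero at almost every point, and
  -- it is dominated by `G` because `n r ≥ 0`.
  have hneg : Filter.Tendsto (fun n : ℕ => ∫ t in c..d, max (-(n * τ.r t - G t)) 0) Filter.atTop
      (nhds (∫ t in c..d, (0 : ℝ))) := by
    refine intervalIntegral.tendsto_integral_filter_of_dominated_convergence G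
      (Filter.Eventually.of_forall fun n =>
        (intervalIntegrable_iff.1 (hII (hnegloc n))).aestronglyMeasurable)
      (Filter.Eventually.of_forall fun n => ?_) (hII hGloc) ?_
    · filter_upwards [hr] with t ht hm
      have : 0 ≤ (n : ℝ) * τ.r t := mul_nonneg (Nat.cast_nonneg n) (ht hm).le
      rw [Real.norm_of_nonneg (le_max_right _ _)]
      exact max_le (by linarith) (hG0 t)
    · filter_upwards [hr] with t ht hm
      refine tendsto_const_nhds.congr' ?_
      obtain ⟨N, hN⟩ := exists_nat_ge (G t / τ.r t)
      filter_upwards [Filter.eventually_ge_atTop N] with n hn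
      have : G t ≤ n * τ.r t := by
        rw [← div_le_iff₀ (ht hm)]
        exact hN.trans (by exact_mod_cast hn)
      rw [max_eq_right (by linarith)]
  rw [intervalIntegral.integral_zero] at hneg
  have hrpos : 0 < ∫ t in c..d, τ.r t := by
    rw [intervalIntegral.integral_pos_iff_support_of_nonneg_ae' ?_ (hII hτ.r_loc)]
    · refine ⟨hcd, ?_⟩
      have : (Function.support τ.r ∩ Ioc c d : Set ℝ) =ᵐ[volume] Ioc c d := by
        filter_upwards [hr] with t ht
        refine propext ⟨fun h => h.2, fun h => ⟨(ht ?_).ne', h⟩⟩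
        rw [uIoc_of_le hcd.le]
        exact h
      rw [measure_congr this]
      simpa using hcd
    · rw [Filter.EventuallyLE, ae_restrict_iff' measurableSet_uIoc]
      filter_upwards [hr] with t ht hm using (ht hm).le
  have hpos : Filter.Tendsto (fun n : ℕ => ∫ t in c..d, max (n * τ.r t - G t) 0) Filter.atTop
      Filter.atTop := by
    refine Filter.tendsto_atTop_mono
      (f := fun n : ℕ => (n : ℝ) * (∫ t in c..d, τ.r t) + -∫ t in c..d, G t) (fun n => ?_) ?_
    · rw [← sub_eq_add_neg, ← intervalIntegral.integral_const_mul,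
        ← intervalIntegral.integral_sub ((hII hτ.r_loc).const_mul _) (hII hGloc)]
      exact intervalIntegral.integral_mono_on hcd.le (hII (hψloc n)) (hII (hposloc n))
        fun t _ => le_max_left _ _
    · exact Filter.tendsto_atTop_add_const_right _ _
        (tendsto_natCast_atTop_atTop.atTop_mul_const hrpos)
  -- `n` is taken so large that the negative part has integral `N ≤ 1` and the positive part has
  -- integral `P ≥ |β - α| + 1`. The choice `φ' = k ψp - ψm` then reaches `β` at `d` when `k P = β -
  -- α + N`. The resulting `k` is at most 1, possibly negative, so `φ' ≤ n r - G`.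
  obtain ⟨n, hn1, hn2⟩ := ((hneg.eventually (ge_mem_nhds one_pos)).and
    (hpos.eventually_ge_atTop (|β - α| + 1))).exists
  set ψp : ℝ → ℝ := fun t => max (n * τ.r t - G t) 0 with hψp
  set ψm : ℝ → ℝ := fun t => max (-(n * τ.r t - G t)) 0 with hψm
  set P := ∫ t in c..d, ψp t with hP
  set N := ∫ t in c..d, ψm t with hN
  have hN0 : 0 ≤ N := intervalIntegral.integral_nonneg hcd.le fun t _ => le_max_right _ _
  have hP0 : 0 < P := lt_of_lt_of_le (by positivity) hn2
  set k := (β - α + N) / P with hk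
  have hkP : k * P = β - α + N := div_mul_cancel₀ _ hP0.ne'
  have habs : |β - α + N| ≤ |β - α| + N := (abs_add_le _ _).trans (by rw [abs_of_nonneg hN0])
  have hkabs : |k| * P = |β - α + N| := by
    rw [← hkP, abs_mul, abs_of_pos hP0]
  have hk1 : k ≤ 1 := by
    rw [hk, div_le_one hP0]
    linarith [le_abs_self (β - α + N)]
  have hloc : LocallyIntegrableOn (fun t => k * ψp t - ψm t) τ.I volume :=
    ((hposloc n).smul k).sub (hnegloc n)
  have hφ := (τ.hasACDeriv_const α).add (hasACDeriv_primitive hloc hc)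
  set φ : ℝ → ℝ := fun t => α + ∫ s in c..t, (k * ψp s - ψm s) with hφdef
  -- `|φ| ≤ |α| + |k| P + N ≤ |α| + |β - α| + 2 N`, and `N ≤ 1` accounts for the constant 2 in `M`.
  have hbound : ∀ t ∈ uIcc c d, |φ t| ≤ M := by
    intro t ht
    rw [uIcc_of_le hcd.le] at ht
    have htI : t ∈ τ.I := τ.uIcc_subset_I hc hd (Icc_subset_uIcc ht)
    have hmaj : LocallyIntegrableOn (fun t => |k| * ψp t + ψm t) τ.I volume :=
      ((hposloc n).smul |k|).add (hnegloc n)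
    have hnonneg : ∀ s, 0 ≤ |k| * ψp s + ψm s := fun s =>
      add_nonneg (mul_nonneg (abs_nonneg _) (le_max_right _ _)) (le_max_right _ _)
    have h1 : ‖∫ s in c..t, (k * ψp s - ψm s)‖ ≤ ∫ s in c..t, (|k| * ψp s + ψm s) := by
      refine intervalIntegral.norm_integral_le_of_norm_le ht.1
        (Filter.Eventually.of_forall fun s _ => ?_)
        (intervalIntegrable_of_locallyIntegrableOn hmaj hc htI)
      refine (norm_sub_le _ _).trans (le_of_eq ?_)
      rw [norm_mul, Real.norm_eq_abs, Real.norm_of_nonneg (le_max_right _ _),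
        Real.norm_of_nonneg (le_max_right _ _)]
    have h2 : ∫ s in c..t, (|k| * ψp s + ψm s) ≤ ∫ s in c..d, (|k| * ψp s + ψm s) :=
      intervalIntegral.integral_mono_interval le_rfl ht.1 ht.2
        (Filter.Eventually.of_forall hnonneg) (hII hmaj)
    have h3 : ∫ s in c..d, (|k| * ψp s + ψm s) = |k| * P + N := by
      rw [intervalIntegral.integral_add ((hII (hposloc n)).const_mul _) (hII (hnegloc n)),
        intervalIntegral.integral_const_mul]
    refine (abs_add_le _ _).trans ?_
    rw [Real.norm_eq_abs] at h1
    linarith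
  refine ⟨-n, φ, ⟨hφ.acLoc c hc d hd, ?_⟩, by simp [hφdef], ?_⟩
  · filter_upwards [ae_uIcc hφ.2 hc hd] with t h1 hm
    refine ⟨_, h1 hm, ?_⟩
    have hb := hbound t hm
    have hb2 : φ t ^ 2 ≤ M ^ 2 := sq_le_sq' (abs_le.1 hb).1 (abs_le.1 hb).2
    have e1 : (τ.p t)⁻¹ * φ t ^ 2 ≤ M ^ 2 * ‖(τ.p t)⁻¹‖ := by
      rw [mul_comm (M ^ 2)]
      exact mul_le_mul (Real.le_norm_self _) hb2 (sq_nonneg _) (norm_nonneg _)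
    have e2 : -(2 * M * ‖τ.s t‖) ≤ 2 * τ.s t * φ t := by
      have : |τ.s t * φ t| ≤ ‖τ.s t‖ * M := by
        rw [abs_mul]
        exact mul_le_mul_of_nonneg_left hb (abs_nonneg _)
      linarith [(abs_le.1 this).1]
    have e3 : -‖τ.q t‖ ≤ τ.q t := neg_abs_le _
    have e4 : k * ψp t - ψm t ≤ n * τ.r t - G t := by
      have : k * ψp t ≤ 1 * ψp t := mul_le_mul_of_nonneg_right hk1 (le_max_right _ _)
      have h6 : ψp t - ψm t = n * τ.r t - G t := by
        simp only [hψp, hψm]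
        rcases le_total 0 (n * τ.r t - G t) with h | h
        · rw [max_eq_left h, max_eq_right (by linarith)]; ring
        · rw [max_eq_right h, max_eq_left (by linarith)]; ring
      linarith
    simp only [hG] at e4
    linarith
  · simp only [hφdef]
    rw [intervalIntegral.integral_sub ((hII (hposloc n)).const_mul _) (hII (hnegloc n)),
      intervalIntegral.integral_const_mul]
    change α + (k * P - N) = β
    rw [hkP]
    ring

theorem Hypothesis.nonempty_I (hτ : τ.Hypothesis) : τ.I.Nonempty := by
  obtain ⟨x, h1, h2⟩ := EReal.lt_iff_exists_real_btwn.1 hτ.a_lt_b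
  exact ⟨x, h1, h2⟩

/-- Any one nontrivial solution serves: non-oscillation says that it has no zeros close to the
endpoint. -/
theorem NonOscillatoryAtLeft.exists_riccatiLE (hτ : τ.Hypothesis) {lam : ℝ}
    (h : τ.NonOscillatoryAtLeft lam) : ∃ (φ : ℝ → ℝ), ∃ c₀ ∈ τ.I,
      ∀ x ∈ τ.I, ∀ y ∈ τ.I, x < c₀ → y < c₀ → τ.RiccatiLE lam φ x y := by
  obtain ⟨x₀, hx₀⟩ := hτ.nonempty_I
  obtain ⟨u, u₁, hu, hu₁, h0, -⟩ := exists_solution hτ lam hx₀ 1 0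
  have : ∃ c ∈ τ.I, ∀ x ∈ τ.I, x < c → u x ≠ 0 := by
    by_contra! hcon
    exact h ⟨u, isRealSolution_of_hasACDeriv hτ hu hu₁, ⟨x₀, hx₀, by simp [h0]⟩, hcon⟩
  obtain ⟨c, hc, hne⟩ := this
  refine ⟨_, c, hc, fun x hx y hy hxc hyc => riccatiLE_of_solution hu hu₁ hx hy fun t ht => ?_⟩
  exact hne t (τ.uIcc_subset_I hx hy ht) (ht.2.trans_lt (max_lt hxc hyc))

theorem NonOscillatoryAtRight.exists_riccatiLE (hτ : τ.Hypothesis) {lam : ℝ}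
    (h : τ.NonOscillatoryAtRight lam) : ∃ (φ : ℝ → ℝ), ∃ d₀ ∈ τ.I,
      ∀ x ∈ τ.I, ∀ y ∈ τ.I, d₀ < x → d₀ < y → τ.RiccatiLE lam φ x y := by
  obtain ⟨x₀, hx₀⟩ := hτ.nonempty_I
  obtain ⟨u, u₁, hu, hu₁, h0, -⟩ := exists_solution hτ lam hx₀ 1 0
  have : ∃ c ∈ τ.I, ∀ x ∈ τ.I, c < x → u x ≠ 0 := by
    by_contra! hcon
    exact h ⟨u, isRealSolution_of_hasACDeriv hτ hu hu₁, ⟨x₀, hx₀, by simp [h0]⟩, hcon⟩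
  obtain ⟨c, hc, hne⟩ := this
  refine ⟨_, c, hc, fun x hx y hy hxc hyc => riccatiLE_of_solution hu hu₁ hx hy fun t ht => ?_⟩
  exact hne t (τ.uIcc_subset_I hx hy ht) ((lt_min hxc hyc).trans_le ht.1)

/-- The quadratic form of `τ - γ` is nonnegative for suitable `γ`. -/
theorem exists_integral_formDensity_nonneg (hτ : τ.Hypothesis)
    (hp : ∀ᵐ x ∂(volume.restrict τ.I), 0 < τ.p x) {lam_a lam_b : ℝ}
    (ha : τ.NonOscillatoryAtLeft lam_a) (hb : τ.NonOscillatoryAtRight lam_b) :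
    ∃ γ : ℝ, ∃ c ∈ τ.I, ∃ d ∈ τ.I, ∀ x ∈ τ.I, ∀ y ∈ τ.I, x ≤ c → d ≤ y → x ≤ y ∧
      ∀ g g₁ : ℝ → ℝ, τ.HasQuasiDeriv g g₁ → g x = 0 → g y = 0 →
        0 ≤ ∫ t in x..y, τ.formDensity γ g g₁ t := by
  obtain ⟨φa, c₀, hc₀, hφa⟩ := ha.exists_riccatiLE hτ
  obtain ⟨φb, d₀, hd₀, hφb⟩ := hb.exists_riccatiLE hτ
  -- Taking `c` below and `d` above both thresholds ensures `c < d`, whatever the order of `c₀` and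
  -- `d₀`.
  obtain ⟨c, hc, hcc⟩ := exists_lt_mem_I (min_mem_I hc₀ hd₀)
  obtain ⟨d, hd, hdd⟩ := exists_gt_mem_I (max_mem_I hc₀ hd₀)
  have hcd : c < d := (hcc.trans_le (min_le_max)).trans hdd
  have hcc₀ := hcc.trans_le (min_le_left _ _)
  have hdd₀ := (le_max_right c₀ d₀).trans_lt hdd
  obtain ⟨γ, φ, hφ, hφc, hφd⟩ := exists_riccatiLE hτ hc hd hcd (φa c) (φb d)
  refine ⟨min γ (min lam_a lam_b), c, hc, d, hd, fun x hx y hy hxc hdy =>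
    ⟨hxc.trans (hcd.le.trans hdy), fun g g₁ hg hgx hgy => ?_⟩⟩
  have h1 := ((hφa x hx c hc (hxc.trans_lt hcc₀) hcc₀).mono hτ hx hc
    ((min_le_right γ (min lam_a lam_b)).trans (min_le_left _ _))).sub_le_integral hτ hp hx hc hxc hg
  have h2 := (hφ.mono hτ hc hd (min_le_left γ (min lam_a lam_b))).sub_le_integral hτ hp hc hd
    hcd.le hg
  have h3 := ((hφb d hd y hy hdd₀ (hdd₀.trans_le hdy)).mono hτ hd hy
    ((min_le_right γ (min lam_a lam_b)).trans (min_le_right _ _))).sub_le_integral hτ hp hd hy hdy hg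
  have hI : ∀ {v w : ℝ}, v ∈ τ.I → w ∈ τ.I → IntervalIntegrable
      (τ.formDensity (min γ (min lam_a lam_b)) g g₁) volume v w := fun hv hw =>
    intervalIntegrable_of_locallyIntegrableOn (locallyIntegrableOn_formDensity hτ _
      hg.acLoc.continuousOn_I hg.acLoc_quasi.continuousOn_I) hv hw
  -- The boundary terms at `c` and `d` cancel since the middle `φ` has the values `φa c` and `φb d`;
  -- those at `x` and `y` vanish with `g`.
  rw [← intervalIntegral.integral_add_adjacent_intervals (hI hx hc) (hI hc hy),
    ← intervalIntegral.integral_add_adjacent_intervals (hI hc hd) (hI hd hy)]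
  rw [hgx] at h1
  rw [hgy] at h3
  rw [hφc, hφd] at h2
  linarith

/-! ### The quadratic form of `T_0`. -/

theorem mem_graph_T0_iff (hτ : τ.Hypothesis) {z : τ.L2 × τ.L2} :
    z ∈ τ.T0.graph ↔ z ∈ τ.maxGraph ∧ z.1 ∈ τ.compactSupp := by
  rw [← graph_Tmax hτ, LinearPMap.mem_graph_iff, LinearPMap.mem_graph_iff]
  constructor
  · rintro ⟨y, h1, h2⟩
    exact ⟨⟨⟨y, y.2.2⟩, h1, h2⟩, h1 ▸ y.2.1⟩
  · rintro ⟨⟨y, h1, h2⟩, h3⟩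
    exact ⟨⟨y, h1.symm ▸ h3, y.2⟩, h1, h2⟩

theorem exists_lt_of_isCompact {K : Set ℝ} (hK : IsCompact K) (hKI : K ⊆ τ.I) {c : ℝ}
    (hc : c ∈ τ.I) : ∃ x ∈ τ.I, x ≤ c ∧ ∀ k ∈ K, x < k := by
  -- Inserting `c` covers empty `K` and yields `x ≤ c` as well.
  obtain ⟨m, hm, hmin⟩ := (hK.insert c).exists_isLeast (insert_nonempty _ _)
  obtain ⟨x, hx, hxm⟩ := exists_lt_mem_I (insert_subset hc hKI hm)
  exact ⟨x, hx, hxm.le.trans (hmin (mem_insert _ _)),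
    fun k hk => hxm.trans_le (hmin (mem_insert_of_mem _ hk))⟩

theorem exists_gt_of_isCompact {K : Set ℝ} (hK : IsCompact K) (hKI : K ⊆ τ.I) {d : ℝ}
    (hd : d ∈ τ.I) : ∃ y ∈ τ.I, d ≤ y ∧ ∀ k ∈ K, k < y := by
  obtain ⟨m, hm, hmax⟩ := (hK.insert d).exists_isGreatest (insert_nonempty _ _)
  obtain ⟨y, hy, hmy⟩ := exists_gt_mem_I (insert_subset hd hKI hm)
  exact ⟨y, hy, (hmax (mem_insert _ _)).trans hmy.le,
    fun k hk => (hmax (mem_insert_of_mem _ hk)).trans_lt hmy⟩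

theorem integral_weight (hτ : τ.Hypothesis) (ψ : ℝ → ℝ) :
    ∫ t, ψ t ∂τ.weight = ∫ t in τ.I, τ.r t * ψ t := by
  rw [weight, integral_withDensity_eq_integral_toReal_smul₀ hτ.r_meas.ennreal_ofReal
    (Filter.Eventually.of_forall fun _ => ENNReal.ofReal_lt_top)]
  refine integral_congr_ae ?_
  filter_upwards [hτ.r_pos] with t ht
  rw [ENNReal.toReal_ofReal ht.le, smul_eq_mul]

theorem integral_weight_eq_intervalIntegral (hτ : τ.Hypothesis) {ψ : ℝ → ℝ} {x y : ℝ}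
    (hx : x ∈ τ.I) (hy : y ∈ τ.I) (hxy : x ≤ y)
    (hψ : ∀ᵐ t ∂(volume.restrict τ.I), t ∉ Ioc x y → ψ t = 0) :
    ∫ t, ψ t ∂τ.weight = ∫ t in x..y, τ.r t * ψ t := by
  rw [integral_weight hτ, intervalIntegral.integral_of_le hxy]
  refine setIntegral_eq_of_subset_of_ae_sdiff_eq_zero τ.measurableSet_I.nullMeasurableSet ?_ ?_
  · exact Ioc_subset_Icc_self.trans (Icc_subset_uIcc.trans (τ.uIcc_subset_I hx hy))
  · rw [ae_restrict_iff' τ.measurableSet_I] at hψ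
    filter_upwards [hψ] with t ht hm
    rw [ht hm.1 hm.2, mul_zero]

/-- Integration by parts for the quadratic form. -/
theorem integral_mul_apply_eq (hτ : τ.Hypothesis) {g g₁ h h₁ : ℝ → ℝ} (hg : τ.HasQuasiDeriv g g₁)
    (hh : τ.HasQuasiDeriv h h₁) {x y : ℝ} (hx : x ∈ τ.I) (hy : y ∈ τ.I) (hgx : g x = 0)
    (hgy : g y = 0) :
    IntervalIntegrable (fun t => τ.r t * (g t * τ.apply h h₁ t)) volume x y ∧
    ∫ t in x..y, τ.r t * (g t * τ.apply h h₁ t) =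
      ∫ t in x..y, ((τ.p t)⁻¹ * (g₁ t * h₁ t) + τ.q t * (g t * h t)) := by
  have ho := τ.isOpen_I.isLocallyClosed
  have hd := (hg.hasACDeriv hτ).mul hh.acLoc_quasi.hasACDeriv_deriv
  have hloc : LocallyIntegrableOn (fun t => (τ.p t)⁻¹ * (g₁ t * h₁ t) + τ.q t * (g t * h t))
      τ.I volume :=
    (hτ.p_inv_loc.mul_continuousOn
      (hg.acLoc_quasi.continuousOn_I.mul hh.acLoc_quasi.continuousOn_I) ho).add
    (hτ.q_loc.mul_continuousOn (hg.acLoc.continuousOn_I.mul hh.acLoc.continuousOn_I) ho)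
  have hII := intervalIntegrable_of_locallyIntegrableOn hloc hx hy
  -- The integrand differs from the form density by `(g h₁)'`, whose integral vanishes with `g` at
  -- the endpoints; the terms in `s` cancel.
  have hae : ∀ᵐ t, t ∈ uIoc x y → ((τ.p t)⁻¹ * (g₁ t * h₁ t) + τ.q t * (g t * h t)) -
      (((τ.p t)⁻¹ * g₁ t - τ.s t * g t) * h₁ t + g t * deriv h₁ t) =
      τ.r t * (g t * τ.apply h h₁ t) := by
    filter_upwards [ae_uIoc hτ.r_pos hx hy] with t ht hm
    have := (ht hm).ne'
    simp only [apply, smul_eq_mul]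
    rw [mul_left_comm (g t), mul_inv_cancel_left₀ this]
    ring
  constructor
  · refine (hII.sub (hd.intervalIntegrable hx hy)).congr_ae ?_
    rwa [Filter.EventuallyEq, ae_restrict_iff' measurableSet_uIoc]
  · rw [← intervalIntegral.integral_congr_ae hae,
      intervalIntegral.integral_sub hII (hd.intervalIntegrable hx hy), hd.integral_eq_sub hx hy,
      hgx, hgy]
    ring

/-- Since `r > 0` a.e., vanishing off `K` for the weight is vanishing Lebesgue-a.e., which
continuity upgrades to every point of the open set `τ.I \ K`. -/
theorem eqOn_zero_of_mem_compactSupp (hτ : τ.Hypothesis) {F : τ.L2} {f : ℝ → ℂ} {K : Set ℝ}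
    (hK : IsCompact K) (hFK : ∀ᵐ x ∂τ.weight, x ∉ K → F x = 0) (hf : τ.ACLoc f)
    (hFf : ∀ᵐ x ∂τ.weight, F x = f x) : ∀ x ∈ τ.I, x ∉ K → f x = 0 := by
  have hopen : IsOpen (τ.I \ K) := τ.isOpen_I.sdiff hK.isClosed
  have : EqOn f 0 (τ.I \ K) := by
    refine Measure.eqOn_open_of_ae_eq (μ := volume) ?_ hopen
      (hf.continuousOn.mono sdiff_subset) continuousOn_const
    have h1 := hτ.ae_of_ae_weight (hFK.and hFf)
    rw [Filter.EventuallyEq, ae_restrict_iff' hopen.measurableSet]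
    rw [ae_restrict_iff' τ.measurableSet_I] at h1
    filter_upwards [h1] with t ht hm
    obtain ⟨h2, h3⟩ := ht hm.1
    rw [← h3, h2 hm.2]
    rfl
  exact fun x hx hxK => this ⟨hx, hxK⟩

/-- The coefficients are real, so for `f = g + i h` the real part of the form is the sum of the
forms of `g` and `h`. The imaginary part is the integral of `r (g τh - h τg)`, which vanishes
because integration by parts leads to a symmetric expression in `g` and `h`. -/
theorem re_inner_eq_and_im_inner_eq_zero (hτ : τ.Hypothesis) {F G : τ.L2} {f f₁ : ℝ → ℂ}
    (hf : τ.HasQuasiDeriv f f₁) (hF : ∀ᵐ x ∂τ.weight, F x = f x)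
    (hG : ∀ᵐ x ∂τ.weight, G x = τ.apply f f₁ x) {x y : ℝ} (hx : x ∈ τ.I) (hy : y ∈ τ.I)
    (hxy : x ≤ y) (hf0 : ∀ t ∈ τ.I, t ∉ Ioo x y → f t = 0) (γ : ℝ) :
    (inner ℂ F G).re - γ * ‖F‖ ^ 2 =
      (∫ t in x..y, τ.formDensity γ (fun t => (f t).re) (fun t => (f₁ t).re) t) +
      (∫ t in x..y, τ.formDensity γ (fun t => (f t).im) (fun t => (f₁ t).im) t) ∧
    (inner ℂ F G).im = 0 := by
  have hg : τ.HasQuasiDeriv (fun t => (f t).re) (fun t => (f₁ t).re) := hf.clm_comp Complex.reCLM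
  have hh : τ.HasQuasiDeriv (fun t => (f t).im) (fun t => (f₁ t).im) := hf.clm_comp Complex.imCLM
  have hτg : ∀ᵐ t ∂(volume.restrict τ.I),
      τ.apply (fun t => (f t).re) (fun t => (f₁ t).re) t = (τ.apply f f₁ t).re :=
    apply_clm_comp (f := f) hf.acLoc_quasi Complex.reCLM
  have hτh : ∀ᵐ t ∂(volume.restrict τ.I),
      τ.apply (fun t => (f t).im) (fun t => (f₁ t).im) t = (τ.apply f f₁ t).im :=
    apply_clm_comp (f := f) hf.acLoc_quasi Complex.imCLM
  set g := fun t => (f t).re with hgdef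
  set g₁ := fun t => (f₁ t).re with hg₁def
  set h := fun t => (f t).im with hhdef
  set h₁ := fun t => (f₁ t).im with hh₁def
  have hfx : f x = 0 := hf0 x hx fun h => lt_irrefl _ h.1
  have hfy : f y = 0 := hf0 y hy fun h => lt_irrefl _ h.2
  have hgx : g x = 0 := by simp [hgdef, hfx]
  have hgy : g y = 0 := by simp [hgdef, hfy]
  have hhx : h x = 0 := by simp [hhdef, hfx]
  have hhy : h y = 0 := by simp [hhdef, hfy]
  have hint := L2.integrable_inner (𝕜 := ℂ) F G
  have hre : (inner ℂ F G).re = ∫ t in x..y, τ.r t *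
      (g t * τ.apply g g₁ t + h t * τ.apply h h₁ t) := by
    rw [L2.inner_def, ← Complex.reCLM_apply, ← Complex.reCLM.integral_comp_comm hint,
      ← integral_weight_eq_intervalIntegral hτ hx hy hxy]
    · refine integral_congr_ae ?_
      filter_upwards [hF, hG, ae_weight hτg, ae_weight hτh] with t h1 h2 h3 h4
      rw [h1, h2, h3, h4]
      simp [RCLike.inner_apply, hgdef, hhdef]
      ring
    · filter_upwards [τ.ae_mem_I] with t ht hm
      have := hf0 t ht fun h => hm (Ioo_subset_Ioc_self h)
      simp [hgdef, hhdef, this]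
  have him : (inner ℂ F G).im = ∫ t in x..y, τ.r t *
      (g t * τ.apply h h₁ t - h t * τ.apply g g₁ t) := by
    rw [L2.inner_def, ← Complex.imCLM_apply, ← Complex.imCLM.integral_comp_comm hint,
      ← integral_weight_eq_intervalIntegral hτ hx hy hxy]
    · refine integral_congr_ae ?_
      filter_upwards [hF, hG, ae_weight hτg, ae_weight hτh] with t h1 h2 h3 h4
      rw [h1, h2, h3, h4]
      simp [RCLike.inner_apply, hgdef, hhdef]
      ring
    · filter_upwards [τ.ae_mem_I] with t ht hm
      have := hf0 t ht fun h => hm (Ioo_subset_Ioc_self h)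
      simp [hgdef, hhdef, this]
  have hnorm : ‖F‖ ^ 2 = ∫ t in x..y, τ.r t * (g t ^ 2 + h t ^ 2) := by
    have e : ‖F‖ ^ 2 = (inner ℂ F F).re := by
      rw [inner_self_eq_norm_sq_to_K]
      norm_num [← Complex.ofReal_pow]
    rw [e, L2.inner_def, ← Complex.reCLM_apply,
      ← Complex.reCLM.integral_comp_comm (L2.integrable_inner (𝕜 := ℂ) F F),
      ← integral_weight_eq_intervalIntegral hτ hx hy hxy]
    · refine integral_congr_ae ?_
      filter_upwards [hF] with t h1
      rw [h1, Complex.reCLM_apply, RCLike.inner_apply, Complex.mul_conj, Complex.ofReal_re,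
        Complex.normSq_apply]
      ring
    · filter_upwards [τ.ae_mem_I] with t ht hm
      have := hf0 t ht fun h => hm (Ioo_subset_Ioc_self h)
      simp [hgdef, hhdef, this]
  have hgg := integral_mul_apply_eq hτ hg hg hx hy hgx hgy
  have hhh := integral_mul_apply_eq hτ hh hh hx hy hhx hhy
  have hgh := integral_mul_apply_eq hτ hg hh hx hy hgx hgy
  have hhg := integral_mul_apply_eq hτ hh hg hx hy hhx hhy
  have ho := τ.isOpen_I.isLocallyClosed
  have hgc := hg.acLoc.continuousOn_I
  have hhc := hh.acLoc.continuousOn_I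
  have hr2 : ∀ {k : ℝ → ℝ}, ContinuousOn k τ.I →
      IntervalIntegrable (fun t => τ.r t * k t ^ 2) volume x y := fun hk =>
    intervalIntegrable_of_locallyIntegrableOn (hτ.r_loc.mul_continuousOn (hk.pow 2) ho) hx hy
  constructor
  · have hform : ∀ {k k₁ : ℝ → ℝ}, τ.HasQuasiDeriv k k₁ →
        ∫ t in x..y, τ.formDensity γ k k₁ t =
          (∫ t in x..y, ((τ.p t)⁻¹ * (k₁ t * k₁ t) + τ.q t * (k t * k t))) -
            γ * ∫ t in x..y, τ.r t * k t ^ 2 := by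
      intro k k₁ hk
      have hkc := hk.acLoc.continuousOn_I
      have hk₁c := hk.acLoc_quasi.continuousOn_I
      have hpq : IntervalIntegrable
          (fun t => (τ.p t)⁻¹ * (k₁ t * k₁ t) + τ.q t * (k t * k t)) volume x y :=
        intervalIntegrable_of_locallyIntegrableOn
          ((hτ.p_inv_loc.mul_continuousOn (hk₁c.mul hk₁c) ho).add
          (hτ.q_loc.mul_continuousOn (hkc.mul hkc) ho)) hx hy
      rw [← intervalIntegral.integral_const_mul, ← intervalIntegral.integral_sub hpq
        ((hr2 hkc).const_mul γ)]
      refine intervalIntegral.integral_congr fun t _ => ?_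
      simp only [formDensity]
      ring
    have h1 : ∫ t in x..y, τ.r t * (g t * τ.apply g g₁ t + h t * τ.apply h h₁ t) =
        (∫ t in x..y, τ.r t * (g t * τ.apply g g₁ t)) +
          ∫ t in x..y, τ.r t * (h t * τ.apply h h₁ t) := by
      rw [← intervalIntegral.integral_add hgg.1 hhh.1]
      exact intervalIntegral.integral_congr fun t _ => mul_add _ _ _
    have h2 : ∫ t in x..y, τ.r t * (g t ^ 2 + h t ^ 2) =
        (∫ t in x..y, τ.r t * g t ^ 2) + ∫ t in x..y, τ.r t * h t ^ 2 := by
      rw [← intervalIntegral.integral_add (hr2 hgc) (hr2 hhc)]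
      exact intervalIntegral.integral_congr fun t _ => mul_add _ _ _
    rw [hre, hnorm, h1, h2, hgg.2, hhh.2, hform hg, hform hh]
    ring
  · have h1 : ∫ t in x..y, τ.r t * (g t * τ.apply h h₁ t - h t * τ.apply g g₁ t) =
        (∫ t in x..y, τ.r t * (g t * τ.apply h h₁ t)) -
          ∫ t in x..y, τ.r t * (h t * τ.apply g g₁ t) := by
      rw [← intervalIntegral.integral_sub hgh.1 hhg.1]
      exact intervalIntegral.integral_congr fun t _ => mul_sub _ _ _
    rw [him, h1, hgh.2, hhg.2, sub_eq_zero]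
    refine intervalIntegral.integral_congr fun t _ => ?_
    ring

/-- `T_0` is bounded from below, and its quadratic form is real. -/
theorem exists_T0_lower_bound (hτ : τ.Hypothesis)
    (hp : ∀ᵐ x ∂(volume.restrict τ.I), 0 < τ.p x) {lam_a lam_b : ℝ}
    (ha : τ.NonOscillatoryAtLeft lam_a) (hb : τ.NonOscillatoryAtRight lam_b) :
    ∃ γ : ℝ, ∀ u : τ.T0.domain, γ * ‖u‖ ^ 2 ≤ (inner ℂ (u : τ.L2) (τ.T0 u)).re ∧
      (inner ℂ (u : τ.L2) (τ.T0 u)).im = 0 := by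
  obtain ⟨γ, c, hc, d, hd, hform⟩ := exists_integral_formDensity_nonneg hτ hp ha hb
  refine ⟨γ, fun u => ?_⟩
  obtain ⟨⟨f, f₁, hf, hF, hG⟩, K, hK, hKI, hFK⟩ :=
    (mem_graph_T0_iff hτ).1 (τ.T0.mem_graph u)
  obtain ⟨x, hx, hxc, hxK⟩ := exists_lt_of_isCompact hK hKI hc
  obtain ⟨y, hy, hdy, hyK⟩ := exists_gt_of_isCompact hK hKI hd
  obtain ⟨hxy, hform⟩ := hform x hx y hy hxc hdy
  have hf0 : ∀ t ∈ τ.I, t ∉ Ioo x y → f t = 0 := fun t ht hm =>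
    eqOn_zero_of_mem_compactSupp hτ hK hFK hf.acLoc hF t ht
      fun htK => hm ⟨hxK t htK, hyK t htK⟩
  obtain ⟨h1, h2⟩ := re_inner_eq_and_im_inner_eq_zero hτ hf hF hG hx hy hxy hf0 γ
  have hfx : f x = 0 := hf0 x hx fun h => lt_irrefl _ h.1
  have hfy : f y = 0 := hf0 y hy fun h => lt_irrefl _ h.2
  have h3 := hform _ _ (hf.clm_comp Complex.reCLM) (by simp [hfx]) (by simp [hfy])
  have h4 := hform _ _ (hf.clm_comp Complex.imCLM) (by simp [hfx]) (by simp [hfy])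
  simp only [Complex.reCLM_apply, Complex.imCLM_apply] at h3 h4
  refine ⟨?_, h2⟩
  have h5 : ‖u‖ = ‖(u : τ.L2)‖ := rfl
  rw [h5]
  dsimp only at h1
  linarith

end SLExpr

/-! ### Finite deficiency of `T_0` at real points. -/

/-- If `C` is dense and the common kernel of finitely many functionals on `C` is contained in `R`,
then the orthogonal complement of `R` is finite-dimensional. -/
theorem Submodule.finiteDimensional_orthogonal_of_ker_le {H V : Type*} [NormedAddCommGroup H]
    [InnerProductSpace ℂ H] [AddCommGroup V] [Module ℂ V] [FiniteDimensional ℂ V]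
    {C R : Submodule ℂ H} (hC : Cᗮ = ⊥) (ℓ : C →ₗ[ℂ] V) (hℓ : ∀ x : C, ℓ x = 0 → (x : H) ∈ R) :
    FiniteDimensional ℂ Rᗮ := by
  obtain ⟨N, hN⟩ := Submodule.exists_isCompl (LinearMap.ker ℓ)
  have hQ : FiniteDimensional ℂ (C ⧸ LinearMap.ker ℓ) := Module.Finite.equiv ℓ.quotKerEquivRange.symm
  have hNfin : FiniteDimensional ℂ N :=
    Module.Finite.equiv (Submodule.quotientEquivOfIsCompl _ _ hN)
  -- A vector of `Rᗮ` orthogonal to `M` is orthogonal to both summands of `C = ker ℓ + N`, hence to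
  -- the dense `C`, hence zero. So the projection onto `M` is injective on `Rᗮ`.
  let M : Submodule ℂ H := N.map C.subtype
  have hMfin : FiniteDimensional ℂ M := inferInstance
  refine FiniteDimensional.of_injective (M.orthogonalProjectionOnto.toLinearMap ∘ₗ Rᗮ.subtype) ?_
  rw [← LinearMap.ker_eq_bot, Submodule.eq_bot_iff]
  intro x hx
  have hxM : (x : H) ∈ Mᗮ := Submodule.orthogonalProjectionOnto_eq_zero_iff.1 hx
  have hxC : (x : H) ∈ Cᗮ := by
    rw [Submodule.mem_orthogonal]
    intro c hc
    obtain ⟨k, hk, n, hn, hkn⟩ := Submodule.mem_sup.1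
      (hN.sup_eq_top ▸ Submodule.mem_top : (⟨c, hc⟩ : C) ∈ LinearMap.ker ℓ ⊔ N)
    have e : c = (k : H) + n := (congrArg Subtype.val hkn).symm
    rw [e, inner_add_left, (Submodule.mem_orthogonal _ _).1 x.2 k (hℓ k hk),
      (Submodule.mem_orthogonal _ _).1 hxM n ⟨n, hn, rfl⟩, add_zero]
  rw [hC, Submodule.mem_bot] at hxC
  exact Subtype.ext hxC

namespace SLExpr

variable {τ : SLExpr}

theorem weight_lt_top_of_isCompact (hτ : τ.Hypothesis) {K : Set ℝ} (hK : IsCompact K)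
    (hKI : K ⊆ τ.I) : τ.weight K < ⊤ := by
  rw [weight, withDensity_apply _ hK.measurableSet, Measure.restrict_restrict hK.measurableSet,
    inter_eq_left.2 hKI]
  have := (hτ.r_loc.integrableOn_compact_subset hKI hK).hasFiniteIntegral
  refine lt_of_le_of_lt (lintegral_mono fun t => ?_) this
  exact Real.ofReal_le_enorm _

theorem ae_weight_mem_I (τ : SLExpr) : ∀ᵐ t ∂τ.weight, t ∈ τ.I := ae_weight τ.ae_mem_I

theorem integrable_mul_of_mem_compactSupp (hτ : τ.Hypothesis) {F : τ.L2} (hF : F ∈ τ.compactSupp)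
    {u : ℝ → ℂ} (hu : ContinuousOn u τ.I) : Integrable (fun t => F t * u t) τ.weight := by
  obtain ⟨K, hK, hKI, hFK⟩ := hF
  have : IsFiniteMeasure (τ.weight.restrict K) :=
    ⟨by rw [Measure.restrict_apply_univ]; exact weight_lt_top_of_isCompact hτ hK hKI⟩
  have h1 : IntegrableOn F K τ.weight := ((Lp.memLp F).restrict K).integrable one_le_two
  have h2 : IntegrableOn (fun t => F t * u t) K τ.weight :=
    h1.mul_continuousOn (hu.mono hKI) hK
  refine h2.integrable_of_ae_notMem_eq_zero ?_
  filter_upwards [hFK] with t ht hm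
  rw [ht hm, zero_mul]

/-- The functional `F ↦ ∫ F u r dx` on the functions with compact support. -/
noncomputable def pairing (hτ : τ.Hypothesis) {u : ℝ → ℂ} (hu : ContinuousOn u τ.I) :
    τ.compactSupp →ₗ[ℂ] ℂ where
  toFun F := ∫ t, F.1 t * u t ∂τ.weight
  map_add' F G := by
    rw [← integral_add (integrable_mul_of_mem_compactSupp hτ F.2 hu)
      (integrable_mul_of_mem_compactSupp hτ G.2 hu)]
    refine integral_congr_ae ?_
    filter_upwards [Lp.coeFn_add F.1 G.1] with t ht
    rw [Submodule.coe_add, ht, Pi.add_apply, add_mul]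
  map_smul' c F := by
    rw [RingHom.id_apply, smul_eq_mul, ← integral_const_mul]
    refine integral_congr_ae ?_
    filter_upwards [Lp.coeFn_smul c F.1] with t ht
    rw [Submodule.coe_smul, ht, Pi.smul_apply, smul_eq_mul, mul_assoc]

/-- If `G` is orthogonal to all compactly supported functions, testing with its truncation to a
compact interval shows that the truncation has norm zero. -/
theorem compactSupp_orthogonal (hτ : τ.Hypothesis) : τ.compactSuppᗮ = ⊥ := by
  rw [Submodule.eq_bot_iff]
  intro G hG
  have hzero : ∀ᵐ t ∂(volume.restrict τ.I), G t = 0 := by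
    refine ae_I_of_uIcc fun x hx y hy => ?_
    have hsub := τ.uIcc_subset_I hx hy
    have hmem : MemLp ((uIcc x y).indicator G) 2 τ.weight :=
      (Lp.memLp G).indicator measurableSet_uIcc
    set F : τ.L2 := hmem.toLp _ with hFdef
    have hF : ∀ᵐ t ∂τ.weight, F t = (uIcc x y).indicator G t := hmem.coeFn_toLp
    have hFC : F ∈ τ.compactSupp := by
      refine ⟨uIcc x y, isCompact_uIcc, hsub, ?_⟩
      filter_upwards [hF] with t ht hm
      rw [ht, indicator_of_notMem hm]
    have h0 : inner ℂ F F = 0 := by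
      rw [← (Submodule.mem_orthogonal _ _).1 hG F hFC, L2.inner_def, L2.inner_def]
      refine integral_congr_ae ?_
      filter_upwards [hF] with t ht
      rw [ht]
      by_cases hm : t ∈ uIcc x y
      · rw [indicator_of_mem hm]
      · rw [indicator_of_notMem hm, inner_zero_left, inner_zero_left]
    have hF0 : F = 0 := inner_self_eq_zero.1 h0
    have h1 : ∀ᵐ t ∂τ.weight, (uIcc x y).indicator G t = 0 := by
      filter_upwards [hF, Lp.coeFn_zero ℂ 2 τ.weight] with t h1 h2
      rw [← h1, hF0]
      exact h2
    filter_upwards [ae_uIcc (hτ.ae_of_ae_weight h1) hx hy] with t ht hm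
    rw [← ht hm, indicator_of_mem hm]
  refine Lp.ext ?_
  filter_upwards [ae_weight hzero, Lp.coeFn_zero ℂ 2 τ.weight] with t h1 h2
  rw [h1, h2]
  rfl

/-- Variation of constants. -/
theorem hasACDeriv_variation {lam : ℝ} {u u₁ v v₁ : ℝ → ℝ}
    (hu : τ.HasACDeriv u (fun t => (τ.p t)⁻¹ * u₁ t - τ.s t * u t))
    (hu₁ : τ.HasACDeriv u₁ (fun t => τ.s t * u₁ t + (τ.q t - lam * τ.r t) * u t))
    (hv : τ.HasACDeriv v (fun t => (τ.p t)⁻¹ * v₁ t - τ.s t * v t))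
    (hv₁ : τ.HasACDeriv v₁ (fun t => τ.s t * v₁ t + (τ.q t - lam * τ.r t) * v t))
    (hW : ∀ t ∈ τ.I, u t * v₁ t - u₁ t * v t = 1) {F A B : ℝ → ℝ}
    (hA : τ.HasACDeriv A (fun t => τ.r t * (F t * v t)))
    (hB : τ.HasACDeriv B (fun t => τ.r t * (F t * u t))) :
    τ.HasACDeriv (fun t => u t * A t - v t * B t)
      (fun t => (τ.p t)⁻¹ * (u₁ t * A t - v₁ t * B t) - τ.s t * (u t * A t - v t * B t)) ∧
    τ.HasACDeriv (fun t => u₁ t * A t - v₁ t * B t)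
      (fun t => τ.s t * (u₁ t * A t - v₁ t * B t) +
        (τ.q t - lam * τ.r t) * (u t * A t - v t * B t) - τ.r t * F t) := by
  constructor
  · refine ((hu.mul hA).sub (hv.mul hB)).congr (Filter.Eventually.of_forall fun t => ?_)
    ring
  · refine ((hu₁.mul hA).sub (hv₁.mul hB)).congr ?_
    filter_upwards [τ.ae_mem_I] with t ht
    -- The derivatives of `A` and `B` contribute `r F (u₁ v - v₁ u)`, which is `-r F` as the
    -- Wronskian is 1.
    linear_combination -(τ.r t * F t) * hW t ht

theorem wronskian_eq {lam : ℝ} {u u₁ v v₁ : ℝ → ℝ}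
    (hu : τ.HasACDeriv u (fun t => (τ.p t)⁻¹ * u₁ t - τ.s t * u t))
    (hu₁ : τ.HasACDeriv u₁ (fun t => τ.s t * u₁ t + (τ.q t - lam * τ.r t) * u t))
    (hv : τ.HasACDeriv v (fun t => (τ.p t)⁻¹ * v₁ t - τ.s t * v t))
    (hv₁ : τ.HasACDeriv v₁ (fun t => τ.s t * v₁ t + (τ.q t - lam * τ.r t) * v t))
    {x y : ℝ} (hx : x ∈ τ.I) (hy : y ∈ τ.I) :
    u y * v₁ y - u₁ y * v y = u x * v₁ x - u₁ x * v x := by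
  have h : τ.HasACDeriv (fun t => u t * v₁ t - u₁ t * v t) (fun _ => 0) :=
    ((hu.mul hv₁).sub (hu₁.mul hv)).congr (Filter.Eventually.of_forall fun t => by ring)
  have := h.integral_eq_sub hx hy
  rw [intervalIntegral.integral_zero] at this
  linarith

/-- For real `F`, integrable and supported in `[c, d]` and orthogonal to a fundamental system of
`τ - lam`, the equation `(τ - lam) f = F` has a solution supported in `[c, d]`. -/
theorem exists_quasiDeriv_of_orthogonal (hτ : τ.Hypothesis) {lam : ℝ} {u u₁ v v₁ : ℝ → ℝ}
    (hu : τ.HasACDeriv u (fun t => (τ.p t)⁻¹ * u₁ t - τ.s t * u t))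
    (hu₁ : τ.HasACDeriv u₁ (fun t => τ.s t * u₁ t + (τ.q t - lam * τ.r t) * u t))
    (hv : τ.HasACDeriv v (fun t => (τ.p t)⁻¹ * v₁ t - τ.s t * v t))
    (hv₁ : τ.HasACDeriv v₁ (fun t => τ.s t * v₁ t + (τ.q t - lam * τ.r t) * v t))
    (hW : ∀ t ∈ τ.I, u t * v₁ t - u₁ t * v t = 1) {F : ℝ → ℝ}
    (hFint : LocallyIntegrableOn (fun t => τ.r t * F t) τ.I volume) {c d : ℝ} (hc : c ∈ τ.I)
    (hF0 : ∀ᵐ t ∂(volume.restrict τ.I), t ∉ Ioc c d → F t = 0)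
    (hFu : ∫ t, F t * u t ∂τ.weight = 0) (hFv : ∫ t, F t * v t ∂τ.weight = 0) :
    ∃ f f₁ : ℝ → ℝ, τ.HasQuasiDeriv f f₁ ∧ (∀ t ∈ τ.I, t ∉ Icc c d → f t = 0) ∧
      ∀ᵐ t ∂(volume.restrict τ.I), τ.apply f f₁ t = lam * f t + F t := by
  -- The primitive from `c` vanishes left of `c` because `F` does, and right of `d` because there it
  -- equals the full integral, zero by orthogonality.
  have hprim : ∀ w : ℝ → ℝ, ContinuousOn w τ.I → ∫ t, F t * w t ∂τ.weight = 0 →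
      τ.HasACDeriv (fun t => ∫ s in c..t, τ.r s * (F s * w s)) (fun t => τ.r t * (F t * w t)) ∧
      ∀ t ∈ τ.I, t ∉ Icc c d → ∫ s in c..t, τ.r s * (F s * w s) = 0 := by
    intro w hw h0
    constructor
    · refine hasACDeriv_primitive ?_ hc
      simp only [← mul_assoc]
      exact hFint.mul_continuousOn hw τ.isOpen_I.isLocallyClosed
    · intro t ht hm
      rcases lt_or_ge t c with htc | hct
      · refine intervalIntegral.integral_zero_ae ?_
        filter_upwards [ae_uIoc hF0 hc ht] with s hs hsm
        rw [hs hsm fun h => ?_, zero_mul, mul_zero]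
        rw [uIoc_of_ge htc.le] at hsm
        exact absurd h.1 (not_lt.2 hsm.2)
      · have hdt : d < t := by
          by_contra! h
          exact hm ⟨hct, h⟩
        rw [← integral_weight_eq_intervalIntegral hτ hc ht hct, h0]
        filter_upwards [hF0] with s hs hsm
        rw [hs fun h => hsm ⟨h.1, h.2.trans hdt.le⟩, zero_mul]
  obtain ⟨hA, hA0⟩ := hprim v hv.continuousOn hFv
  obtain ⟨hB, hB0⟩ := hprim u hu.continuousOn hFu
  obtain ⟨hf, hf₁⟩ := hasACDeriv_variation hu hu₁ hv hv₁ hW hA hB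
  refine ⟨_, _, hf.hasQuasiDeriv hτ hf₁, fun t ht hm => ?_, ?_⟩
  · rw [hA0 t ht hm, hB0 t ht hm]
    ring
  · filter_upwards [hf₁.ae_deriv_eq, hτ.r_pos] with t h1 h2
    simp only [apply, smul_eq_mul]
    rw [h1, inv_mul_eq_iff_eq_mul₀ h2.ne']
    ring

theorem locallyIntegrableOn_mul_of_integrable (hτ : τ.Hypothesis) {F : ℝ → ℝ}
    (hF : Integrable F τ.weight) : LocallyIntegrableOn (fun t => τ.r t * F t) τ.I volume := by
  refine IntegrableOn.locallyIntegrableOn ?_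
  rw [weight, integrable_withDensity_iff_integrable_smul₀' hτ.r_meas.ennreal_ofReal
    (Filter.Eventually.of_forall fun _ => ENNReal.ofReal_lt_top)] at hF
  refine hF.congr ?_
  filter_upwards [hτ.r_pos] with t ht
  rw [ENNReal.toReal_ofReal ht.le, smul_eq_mul]

theorem memLp_of_continuousOn (hτ : τ.Hypothesis) {f : ℝ → ℂ} (hf : ContinuousOn f τ.I) {K : Set ℝ}
    (hK : IsCompact K) (hKI : K ⊆ τ.I) (hf0 : ∀ t ∈ τ.I, t ∉ K → f t = 0) :
    MemLp f 2 τ.weight := by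
  have hind : MemLp (K.indicator f) 2 τ.weight := by
    rw [memLp_indicator_iff_restrict hK.measurableSet]
    have : IsFiniteMeasure (τ.weight.restrict K) :=
      ⟨by rw [Measure.restrict_apply_univ]; exact weight_lt_top_of_isCompact hτ hK hKI⟩
    obtain ⟨C, hC⟩ := hK.exists_bound_of_continuousOn (hf.mono hKI)
    refine MemLp.of_bound ((hf.mono hKI).aestronglyMeasurable hK.measurableSet) C ?_
    rw [ae_restrict_iff' hK.measurableSet]
    exact Filter.Eventually.of_forall hC
  refine hind.ae_eq ?_
  filter_upwards [τ.ae_weight_mem_I] with t ht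
  by_cases hm : t ∈ K
  · rw [indicator_of_mem hm]
  · rw [indicator_of_notMem hm, hf0 t ht hm]

/-- As `u` and `v` are real, the orthogonality relations pass to the real and imaginary parts of
`F`. Solving for each by variation of constants gives compactly supported `g` and `h`, and `g + i h`
is the preimage of `F`. -/
theorem mem_range_T0_of_pairing_eq_zero (hτ : τ.Hypothesis) {lam : ℝ} {u u₁ v v₁ : ℝ → ℝ}
    (hu : τ.HasACDeriv u (fun t => (τ.p t)⁻¹ * u₁ t - τ.s t * u t))
    (hu₁ : τ.HasACDeriv u₁ (fun t => τ.s t * u₁ t + (τ.q t - lam * τ.r t) * u t))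
    (hv : τ.HasACDeriv v (fun t => (τ.p t)⁻¹ * v₁ t - τ.s t * v t))
    (hv₁ : τ.HasACDeriv v₁ (fun t => τ.s t * v₁ t + (τ.q t - lam * τ.r t) * v t))
    (hW : ∀ t ∈ τ.I, u t * v₁ t - u₁ t * v t = 1) {F : τ.L2} (hF : F ∈ τ.compactSupp)
    (hFu : ∫ t, F t * (u t : ℂ) ∂τ.weight = 0) (hFv : ∫ t, F t * (v t : ℂ) ∂τ.weight = 0) :
    F ∈ τ.T0.graph.map
      (LinearMap.snd ℂ τ.L2 τ.L2 - (lam : ℂ) • LinearMap.fst ℂ τ.L2 τ.L2) := by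
  have hint : Integrable F τ.weight := by
    simpa using integrable_mul_of_mem_compactSupp hτ hF (continuousOn_const (c := (1 : ℂ)))
  have hcomp : ∀ L : ℂ →L[ℝ] ℝ, (∀ (z : ℂ) (x : ℝ), L (z * x) = L z * x) → ∀ w : ℝ → ℝ,
      ContinuousOn w τ.I → ∫ t, F t * (w t : ℂ) ∂τ.weight = 0 →
      ∫ t, L (F t) * w t ∂τ.weight = 0 := by
    intro L hL w hw h0
    have hi := integrable_mul_of_mem_compactSupp hτ hF (u := fun t => (w t : ℂ))
      (Complex.continuous_ofReal.comp_continuousOn hw)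
    have := L.integral_comp_comm hi
    rw [h0, map_zero] at this
    simpa only [hL] using this
  obtain ⟨K, hK, hKI, hFK⟩ := hF
  obtain ⟨x₀, hx₀⟩ := hτ.nonempty_I
  obtain ⟨c, hc, -, hcK⟩ := exists_lt_of_isCompact hK hKI hx₀
  obtain ⟨d, hd, -, hdK⟩ := exists_gt_of_isCompact hK hKI hx₀
  have hF0 : ∀ᵐ t ∂(volume.restrict τ.I), t ∉ Ioc c d → F t = 0 := by
    filter_upwards [hτ.ae_of_ae_weight hFK] with t ht hm
    exact ht fun htK => hm ⟨hcK t htK, (hdK t htK).le⟩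
  have hsolve : ∀ L : ℂ →L[ℝ] ℝ, (∀ (z : ℂ) (x : ℝ), L (z * x) = L z * x) →
      ∃ f f₁ : ℝ → ℝ, τ.HasQuasiDeriv f f₁ ∧ (∀ t ∈ τ.I, t ∉ Icc c d → f t = 0) ∧
        ∀ᵐ t ∂(volume.restrict τ.I), τ.apply f f₁ t = lam * f t + L (F t) := by
    intro L hL
    refine exists_quasiDeriv_of_orthogonal hτ hu hu₁ hv hv₁ hW
      (locallyIntegrableOn_mul_of_integrable hτ (L.integrable_comp hint)) hc ?_
      (hcomp L hL u hu.continuousOn hFu) (hcomp L hL v hv.continuousOn hFv)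
    filter_upwards [hF0] with t ht hm
    rw [ht hm, map_zero]
  obtain ⟨g, g₁, hg, hg0, hτg⟩ := hsolve Complex.reCLM (by simp)
  obtain ⟨h, h₁, hh, hh0, hτh⟩ := hsolve Complex.imCLM (by simp)
  have hgC : τ.HasQuasiDeriv (fun t => (g t : ℂ)) (fun t => (g₁ t : ℂ)) :=
    hg.clm_comp Complex.ofRealCLM
  have hhC : τ.HasQuasiDeriv (fun t => (h t : ℂ)) (fun t => (h₁ t : ℂ)) :=
    hh.clm_comp Complex.ofRealCLM
  have hτgC : ∀ᵐ t ∂(volume.restrict τ.I),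
      τ.apply (fun t => (g t : ℂ)) (fun t => (g₁ t : ℂ)) t = (τ.apply g g₁ t : ℝ) :=
    apply_clm_comp (f := g) hg.acLoc_quasi Complex.ofRealCLM
  have hτhC : ∀ᵐ t ∂(volume.restrict τ.I),
      τ.apply (fun t => (h t : ℂ)) (fun t => (h₁ t : ℂ)) t = (τ.apply h h₁ t : ℝ) :=
    apply_clm_comp (f := h) hh.acLoc_quasi Complex.ofRealCLM
  have hf := hgC.add (hhC.smul Complex.I)
  set f : ℝ → ℂ := (fun t => (g t : ℂ)) + Complex.I • fun t => (h t : ℂ) with hfdef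
  set f₁ : ℝ → ℂ := (fun t => (g₁ t : ℂ)) + Complex.I • fun t => (h₁ t : ℂ) with hf₁def
  have hfapp : ∀ t, f t = g t + Complex.I * h t := fun t => rfl
  have hf0 : ∀ t ∈ τ.I, t ∉ uIcc c d → f t = 0 := fun t ht hm => by
    have hm' : t ∉ Icc c d := fun h => hm (Icc_subset_uIcc h)
    rw [hfapp, hg0 t ht hm', hh0 t ht hm']
    simp
  have hsub := τ.uIcc_subset_I hc hd
  have hfmem := memLp_of_continuousOn hτ hf.acLoc.continuousOn isCompact_uIcc hsub hf0
  have hτf : ∀ᵐ t ∂τ.weight, τ.apply f f₁ t = lam * f t + F t := by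
    filter_upwards [apply_add_ae hgC (hhC.smul Complex.I), ae_weight hτgC, ae_weight hτhC,
      ae_weight hτg, ae_weight hτh] with t h1 h2 h3 h4 h5
    rw [h1, apply_smul, h2, h3, h4, h5, hfapp]
    conv_rhs => rw [← Complex.re_add_im (F t)]
    simp only [Complex.reCLM_apply, Complex.imCLM_apply, smul_eq_mul]
    push_cast
    ring
  set U : τ.L2 := hfmem.toLp f with hU
  have hUf : ∀ᵐ t ∂τ.weight, U t = f t := hfmem.coeFn_toLp
  refine ⟨(U, (lam : ℂ) • U + F), (mem_graph_T0_iff hτ).2 ⟨⟨f, f₁, hf, hUf, ?_⟩, ?_⟩, ?_⟩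
  · filter_upwards [hUf, hτf, Lp.coeFn_add ((lam : ℂ) • U) F, Lp.coeFn_smul (lam : ℂ) U]
      with t h1 h2 h3 h4
    rw [h2, h3, Pi.add_apply, h4, Pi.smul_apply, h1, smul_eq_mul]
  · refine ⟨uIcc c d, isCompact_uIcc, hsub, ?_⟩
    filter_upwards [hUf, τ.ae_weight_mem_I] with t h1 h2 hm
    rw [h1, hf0 t h2 hm]
  · exact add_sub_cancel_left ((lam : ℂ) • U) F

/-- The deficiency spaces of `T_0` at real points are finite-dimensional. -/
theorem finiteDimensional_orthogonal_range_T0 (hτ : τ.Hypothesis) (lam : ℝ) :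
    FiniteDimensional ℂ (τ.T0.graph.map
      (LinearMap.snd ℂ τ.L2 τ.L2 - (lam : ℂ) • LinearMap.fst ℂ τ.L2 τ.L2))ᗮ := by
  obtain ⟨x₀, hx₀⟩ := hτ.nonempty_I
  obtain ⟨u, u₁, hu, hu₁, hux, hu₁x⟩ := exists_solution hτ lam hx₀ 1 0
  obtain ⟨v, v₁, hv, hv₁, hvx, hv₁x⟩ := exists_solution hτ lam hx₀ 0 1
  have hW : ∀ t ∈ τ.I, u t * v₁ t - u₁ t * v t = 1 := fun t ht => by
    rw [wronskian_eq hu hu₁ hv hv₁ hx₀ ht, hux, hu₁x, hvx, hv₁x]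
    norm_num
  have huc : ContinuousOn (fun t => (u t : ℂ)) τ.I :=
    Complex.continuous_ofReal.comp_continuousOn hu.continuousOn
  have hvc : ContinuousOn (fun t => (v t : ℂ)) τ.I :=
    Complex.continuous_ofReal.comp_continuousOn hv.continuousOn
  -- The two functionals are the pairings with the fundamental system `u`, `v`, so only two
  -- conditions have to be imposed.
  refine Submodule.finiteDimensional_orthogonal_of_ker_le (compactSupp_orthogonal hτ)
    ((pairing hτ huc).prod (pairing hτ hvc)) fun F hF => ?_
  exact mem_range_T0_of_pairing_eq_zero hτ hu hu₁ hv hv₁ hW F.2 (congrArg Prod.fst hF)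
    (congrArg Prod.snd hF)

end SLExpr

/-! ### The main theorem. -/

theorem LinearPMap.isBoundedFromBelow_of_re_of_im {H : Type*} [NormedAddCommGroup H]
    [InnerProductSpace ℂ H] {T : H →ₗ.[ℂ] H} {γ : ℝ}
    (hre : ∀ u : T.domain, γ * ‖u‖ ^ 2 ≤ (inner ℂ (u : H) (T u)).re)
    (him : ∀ u : T.domain, (inner ℂ (u : H) (T u)).im = 0) : T.IsBoundedFromBelow := by
  refine ⟨γ, fun u => ?_⟩
  have e : (γ : ℂ) * inner ℂ (u : H) (u : H) = ((γ * ‖u‖ ^ 2 : ℝ) : ℂ) := by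
    rw [inner_self_eq_norm_sq_to_K]
    push_cast
    rfl
  rw [e, Complex.le_def]
  exact ⟨by rw [Complex.ofReal_re]; exact hre u, by rw [Complex.ofReal_im]; exact (him u).symm⟩

theorem theoremt10p8 (τ : SLExpr) (hτ : τ.Hypothesis)
    (hp : ∀ᵐ x ∂(MeasureTheory.volume.restrict τ.I), 0 < τ.p x)
    (lam_a lam_b : ℝ)
    (ha : τ.NonOscillatoryAtLeft lam_a) (hb : τ.NonOscillatoryAtRight lam_b) :
    τ.T0.IsBoundedFromBelow ∧
      ∀ S : τ.L2 →ₗ.[ℂ] τ.L2, IsSelfAdjoint S → τ.Tmin ≤ S → S.IsBoundedFromBelow := by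
  obtain ⟨γ, hγ⟩ := SLExpr.exists_T0_lower_bound hτ hp ha hb
  refine ⟨LinearPMap.isBoundedFromBelow_of_re_of_im (fun u => (hγ u).1) fun u => (hγ u).2, ?_⟩
  intro S hS hTS
  have hsymm : S.IsFormalAdjoint S := by
    have := LinearPMap.adjoint_isFormalAdjoint hS.dense_domain
    rwa [LinearPMap.isSelfAdjoint_def.1 hS] at this
  -- The spectral parameter `γ - 1` lies strictly below the bound of `T_0`. Of `Tmin ≤ S` only the
  -- consequence that `S` extends `T_0` is needed, as `S` is closed.
  obtain ⟨γ', hγ'⟩ := LinearPMap.bounded_below_of_finite_deficiency hsymm hS.isClosed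
    ((LinearPMap.le_closure τ.T0).trans hTS) (sub_one_lt γ) (fun u => (hγ u).1)
    (SLExpr.finiteDimensional_orthogonal_range_T0 hτ (γ - 1))
  refine LinearPMap.isBoundedFromBelow_of_re_of_im hγ' fun u => ?_
  have h := hsymm u u
  rw [← inner_conj_symm] at h
  exact Complex.conj_eq_iff_im.1 h
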